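/- Let $\mathcal V$ be a finite nonempty set of agents, $\bar h\ge 0$, and for $i,j\in\mathcal V$ let $a_{ij}:[0,\infty)\to[0,\infty)$ be locally integrable weights and (for $i\ne j$) $h_{ij}:[0,\infty)\to[0,\bar h]$ Lebesgue measurable delays. Consider the delayed flow $$\dot x_i(t)=\sum_{j\ne i}a_{ij}(t)\bigl(x_j(t-h_{ij}(t))-x_i(t)\bigr),\qquad i\in\mathcal V. \tag{1}$$ A solution of (1) started at time $t_*\ge 0$ is a function $x$ on $[t_*-\bar h,\infty)$ with values in $\mathbb R^{\mathcal V}$ that is measurable and essentially bounded on $[t_*-\bar h,t_*)$ (the initial history), takes an arbitrary value $x(t_*)$ at $t_*$, is locally absolutely continuous on $[t_*,\infty)$, and satisfies (1) for almost every $t\ge t_*$. The algorithm (1) is said to establish consensus in a group $\mathcal V'\subseteq\mathcal V$ if for every $t_*\ge0$ and every solution started at $t_*$ the limits $\lim_{t\to\infty}x_i(t)$, $i\in\mathcal V'$, exist and coincide; consensus between $i$ and $j$ is consensus in $\{i,j\}$, and global consensus is consensus in $\mathcal V$. The persistent graph $\mathcal G_\infty$ has the node set $\mathcal V$ and an arc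 from $j$ to $i$ if and only if $\int_0^\infty a_{ij}(t)\,dt=\infty$. **Theorem.** Assume that (a) (non-instantaneous type-symmetry, NITS) there are a strictly increasing sequence $0\le t_0<t_1<\dots$ with $t_p\to\infty$ and a constant $K\ge1$ such that $$\frac1K\int_{t_p}^{t_{p+1}}a_{ji}(t)\,dt\le\int_{t_p}^{t_{p+1}}a_{ij}(t)\,dt\le K\int_{t_p}^{t_{p+1}}a_{ji}(t)\,dt\quad\text{for all }p\ge0,\ i,j\in\mathcal V,$$ and $\sup_{p\ge0,\,i\ne j}\int_{t_p}^{t_{p+1}}a_{ij}(t)\,dt<\infty$; (b) for every $D>0$, $\ \sup_{t\ge0,\;i,j\in\mathcal V}\int_t^{t+D}a_{ij}(s)\,ds<\infty$. Then: 1. for every solution of (1), started at any time $t_*\ge0$, the limit $\lim_{t\to\infty}x_i(t)$ exists for every $i\in\mathcal V$; 2. $\mathcal G_\infty$ is undirected (it contains the arc $(i,j)$ if and only if it contains $(j,i)$), and two nodes $i,j$ lie in the same connected component of $\mathcal G_\infty$ if and only if there is a walk (possibly of length zero) from $i$ to $j$ in $\mathcal G_\infty$; 3. for all $i,j\in\mathcal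 V$, the algorithm (1) establishes consensus between $i$ and $j$ if and only if $i$ and $j$ lie in the same connected component of $\mathcal G_\infty$; 4. the algorithm (1) establishes global consensus if and only if $\mathcal G_\infty$ is connected. -/

import Mathlib

open MeasureTheory Filter Topology

namespace DelayedConsensus

/-- The standing assumption on the weights `A t i j` (influence of agent `j` on agent `i` at time
`t ≥ 0`) and on the delays `h i j t`: the weights are nonnegative and locally summable on `[0, ∞)`,
the delays are Lebesgue measurable on `[0, ∞)` with values in `[0, hbar]`. -/
structure IsAdmissible {V : Type*} (hbar : ℝ) (A : ℝ → Matrix V V ℝ) (h : V → V → ℝ → ℝ) :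
    Prop where
  hbar_nonneg : 0 ≤ hbar
  weight_nonneg : ∀ t, 0 ≤ t → ∀ i j, 0 ≤ A t i j
  weight_locallyIntegrable : ∀ i j, LocallyIntegrableOn (fun t => A t i j) (Set.Ici 0)
  delay_mem : ∀ i j, i ≠ j → ∀ t, 0 ≤ t → h i j t ∈ Set.Icc 0 hbar
  delay_measurable : ∀ i j, i ≠ j → AEMeasurable (h i j) (volume.restrict (Set.Ici 0))

/-- `x` (read on `[tstar - hbar, ∞)`) is a solution, started at time `tstar ≥ 0`, of the delayed
flow `x_i'(t) = ∑_{j ≠ i} a_ij(t) (x_j(t - h_ij(t)) - x_i(t))`. The initial data are the value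
`x tstar` and the essentially bounded function to which `x` restricts on `[tstar - hbar, tstar)`
(`x` may jump at `tstar`). On `[tstar, ∞)` the solution is locally absolutely continuous and the
equation holds almost everywhere. -/
structure IsSolution {V : Type*} [Fintype V] [DecidableEq V] (hbar : ℝ) (A : ℝ → Matrix V V ℝ)
    (h : V → V → ℝ → ℝ) (tstar : ℝ) (x : ℝ → V → ℝ) : Prop where
  start_nonneg : 0 ≤ tstar
  history : ∀ i, MemLp (fun t => x t i) ⊤ (volume.restrict (Set.Ico (tstar - hbar) tstar))
  absolutelyContinuous : ∀ i, ∀ T, tstar ≤ T →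
    AbsolutelyContinuousOnInterval (fun t => x t i) tstar T
  equation : ∀ i, ∀ᵐ t ∂(volume.restrict (Set.Ici tstar)),
    HasDerivAt (fun s => x s i)
      (∑ j ∈ Finset.univ.erase i, A t i j * (x (t - h i j t) j - x t i)) t

/-- The algorithm establishes consensus in the group of agents `S`: for every starting time and all
initial data the values of the agents in `S` converge, and they have the same limit. -/
def EstablishesConsensus {V : Type*} [Fintype V] [DecidableEq V] (hbar : ℝ)
    (A : ℝ → Matrix V V ℝ) (h : V → V → ℝ → ℝ) (S : Set V) : Prop :=
  ∀ (tstar : ℝ) (x : ℝ → V → ℝ), IsSolution hbar A h tstar x →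
    ∃ c : ℝ, ∀ i ∈ S, Tendsto (fun t => x t i) atTop (𝓝 c)

/-- The persistent graph: an arc goes from `j` to `i` iff `∫_0^∞ a_ij(t) dt = ∞`. -/
def persistentGraph {V : Type*} (A : ℝ → Matrix V V ℝ) : Digraph V where
  Adj j i := ∫⁻ t in Set.Ici (0 : ℝ), ENNReal.ofReal (A t i j) = ⊤

/-- Uniform local summability: `sup_{t ≥ 0, i, j} ∫_t^{t+D} a_ij(s) ds < ∞` for every `D > 0`. -/
def UniformlyLocallySummable {V : Type*} (A : ℝ → Matrix V V ℝ) : Prop :=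
  ∀ D : ℝ, 0 < D → ∃ μ : ℝ, ∀ t : ℝ, 0 ≤ t → ∀ i j, ∫ s in t..(t + D), A s i j ≤ μ

/-- `A` is bounded along the sequence `τ`: `sup_{p, i ≠ j} ∫_{τ_p}^{τ_{p+1}} a_ij(s) ds < ∞`. -/
def IsBoundedAlong {V : Type*} (A : ℝ → Matrix V V ℝ) (τ : ℕ → ℝ) : Prop :=
  ∃ ℓ : ℝ, ∀ (p : ℕ) (i j : V), i ≠ j → ∫ s in (τ p)..(τ (p + 1)), A s i j ≤ ℓ

/-- Non-instantaneous type-symmetry (NITS). -/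
def IsNITS {V : Type*} (A : ℝ → Matrix V V ℝ) : Prop :=
  ∃ (τ : ℕ → ℝ) (K : ℝ), 0 ≤ τ 0 ∧ StrictMono τ ∧ Tendsto τ atTop atTop ∧ 1 ≤ K ∧
    (∀ (p : ℕ) (i j : V),
      1 / K * ∫ t in (τ p)..(τ (p + 1)), A t j i ≤ ∫ t in (τ p)..(τ (p + 1)), A t i j ∧
      ∫ t in (τ p)..(τ (p + 1)), A t i j ≤ K * ∫ t in (τ p)..(τ (p + 1)), A t j i) ∧
    IsBoundedAlong A τ

end DelayedConsensus

/-!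
Convergence is proved through upper envelopes on a sequence of windows. Consecutive windows of the
type-symmetry assumption are first merged until each is at least as long as the largest delay;
uniform local summability keeps the integrated weights bounded (`exists_isWindowing`). Let `X p i`
be the largest value of agent `i` on the `p`-th window and one delay before it. Every delayed value
which enters the equations on that window is at most `X p j`, so a scalar comparison estimate
(`le_of_weighted_pull`) turns the delayed flow into recurrent inequalities without delays: the
envelope of an agent rises only through the pull of agents with larger envelopes, the pull of agents
with smaller envelopes makes the agent fall below its envelope by the end of the window, and this
fall is still visible in the envelope two windows later, because a fixed fraction of any distance
to an upper bound is kept (`IsSolution.isEnvelopeSystem`).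

The inequalities are then summed. Rank the agents by envelope, and let the flow through the cut
below rank `k` be the integrated weight across the cut times the gap between the two consecutive
envelopes. The sum of the `k + 1` largest envelopes is bounded below. Over two windows it decreases
by a multiple of the flow through the cut below rank `k`, up to a multiple of the flows through the
cuts above, which by type-symmetry control all rises inside the top group
(`IsEnvelopeSystem.exists_cutFlow_le`). By induction on `k` all these flows are summable, so the
total pulls `∑ p, ∑ j, α p i j * max (X p j - X p i) 0` are finite
(`IsEnvelopeSystem.summable_inflow`). Hence the envelopes converge, the solution stays
asymptotically at its envelope, and two agents with distinct limits have summable integrated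
weights, that is, they are not adjacent in the persistent graph.

Conversely, let the agents reachable from `i` form a group not containing `j`. All weights across
its boundary are integrable. A solution with constant history equal to `1` on the group and `0`
outside exists by monotone iteration of the variation of constants operator (`exists_isSolution`).
If it starts late, a maximum principle bounds its motion on either side by the remaining weight
across the boundary (`IsSolution.le_integral_externalWeight`), so the two sides stay apart.
-/

namespace DelayedConsensus

/-! ### Flows between ranked agents -/

/-- Total upward pull on agent `i`, for the couplings `a` and the values `x`. -/
def inflow {V : Type*} [Fintype V] (a : V → V → ℝ) (x : V → ℝ) (i : V) : ℝ :=
  ∑ j, a i j * max (x j - x i) 0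

/-- Total downward pull on agent `i`, for the couplings `a` and the values `x`. -/
def outflow {V : Type*} [Fintype V] (a : V → V → ℝ) (x : V → ℝ) (i : V) : ℝ :=
  ∑ j, a i j * max (x i - x j) 0

lemma inflow_nonneg {V : Type*} [Fintype V] {a : V → V → ℝ} (ha : ∀ i j, 0 ≤ a i j)
    (x : V → ℝ) (i : V) : 0 ≤ inflow a x i :=
  Finset.sum_nonneg fun j _ => mul_nonneg (ha i j) (le_max_right _ _)

lemma outflow_nonneg {V : Type*} [Fintype V] {a : V → V → ℝ} (ha : ∀ i j, 0 ≤ a i j)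
    (x : V → ℝ) (i : V) : 0 ≤ outflow a x i :=
  Finset.sum_nonneg fun j _ => mul_nonneg (ha i j) (le_max_right _ _)

/-- `r` ranks the agents `0, 1, …` by decreasing value of `x`, and `z k` is the value of the agent
of rank `k`. Beyond the last rank `z` is an arbitrary antitone continuation, so that gaps
`z k - z (k + 1)` are nonnegative for all `k`. -/
structure IsRanking {V : Type*} [Fintype V] (x : V → ℝ) (r : V → ℕ) (z : ℕ → ℝ) : Prop where
  injective : Function.Injective r
  surj : ∀ k, k < Fintype.card V → ∃ i, r i = k
  val : ∀ i, x i = z (r i)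
  anti : Antitone z

lemma exists_isRanking {V : Type*} [Fintype V] [Nonempty V] (x : V → ℝ) :
    ∃ r z, IsRanking x r z := by
  classical
  obtain ⟨n, hn⟩ : ∃ n, Fintype.card V = n + 1 :=
    ⟨Fintype.card V - 1, by have := Fintype.card_pos (α := V); omega⟩
  let e : V ≃ Fin (n + 1) := Fintype.equivFinOfCardEq hn
  let f : Fin (n + 1) → ℝ := fun k => -x (e.symm k)
  let s := Tuple.sort f
  have hmono : Monotone (f ∘ s) := Tuple.monotone_sort f
  refine ⟨fun i => (s.symm (e i)).val, fun k => -f (s ⟨min k n, by omega⟩), ?_, ?_, ?_, ?_⟩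
  · intro i j hij
    exact e.injective (s.symm.injective (Fin.ext hij))
  · intro k hk
    exact ⟨e.symm (s ⟨k, by omega⟩), by simp⟩
  · intro i
    have h : (s.symm (e i)).val ≤ n := by omega
    simp [min_eq_left h, f]
  · intro k l hkl
    exact neg_le_neg (hmono (Fin.mk_le_mk.2 (min_le_min_right n hkl)))

/-- The agents of rank at most `k`. -/
def topSet {V : Type*} [Fintype V] (r : V → ℕ) (k : ℕ) : Finset V :=
  Finset.univ.filter fun i => r i ≤ k

/-- Total coupling of the agents of rank at most `k` to the agents of larger rank. -/
def cutWeight {V : Type*} [Fintype V] (a : V → V → ℝ) (r : V → ℕ) (k : ℕ) : ℝ :=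
  ∑ i, ∑ j, if r i ≤ k ∧ k < r j then a i j else 0

/-- Flow through the cut below rank `k`: the coupling times the gap between consecutive values. -/
def cutFlow {V : Type*} [Fintype V] (a : V → V → ℝ) (r : V → ℕ) (z : ℕ → ℝ) (k : ℕ) : ℝ :=
  cutWeight a r k * (z k - z (k + 1))

section Ranking

variable {V : Type*} [Fintype V] {x : V → ℝ} {r : V → ℕ} {z : ℕ → ℝ}

@[simp] lemma mem_topSet {k : ℕ} {i : V} : i ∈ topSet r k ↔ r i ≤ k := by
  simp [topSet]

lemma IsRanking.card_topSet (h : IsRanking x r z) {k : ℕ} (hk : k + 1 < Fintype.card V) :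
    (topSet r k).card = k + 1 := by
  classical
  have himg : (topSet r k).image r = Finset.range (k + 1) := by
    ext m
    simp only [Finset.mem_image, mem_topSet, Finset.mem_range]
    constructor
    · rintro ⟨i, hi, rfl⟩
      omega
    · intro hm
      obtain ⟨i, rfl⟩ := h.surj m (by omega)
      exact ⟨i, by omega, rfl⟩
  rw [← Finset.card_image_of_injective _ h.injective, himg, Finset.card_range]

lemma IsRanking.gap_nonneg (h : IsRanking x r z) (k : ℕ) : 0 ≤ z k - z (k + 1) :=
  sub_nonneg.2 (h.anti (Nat.le_succ k))

lemma cutWeight_nonneg {a : V → V → ℝ} (ha : ∀ i j, 0 ≤ a i j) (k : ℕ) :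
    0 ≤ cutWeight a r k :=
  Finset.sum_nonneg fun i _ => Finset.sum_nonneg fun j _ => by split_ifs <;> simp [ha]

lemma IsRanking.cutFlow_nonneg (h : IsRanking x r z) {a : V → V → ℝ} (ha : ∀ i j, 0 ≤ a i j)
    (k : ℕ) : 0 ≤ cutFlow a r z k :=
  mul_nonneg (cutWeight_nonneg ha k) (h.gap_nonneg k)

lemma IsRanking.cutFlow_le (h : IsRanking x r z) {a : V → V → ℝ} {l : ℝ} (hl : 0 ≤ l)
    (ha : ∀ i j, i ≠ j → a i j ≤ l) (k : ℕ) :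
    cutFlow a r z k ≤ Fintype.card V * (Fintype.card V * l) * (z k - z (k + 1)) := by
  refine mul_le_mul_of_nonneg_right ?_ (h.gap_nonneg k)
  have : ∀ i ∈ (Finset.univ : Finset V), (∑ j, if r i ≤ k ∧ k < r j then a i j else 0) ≤
      Fintype.card V * l := by
    intro i _
    have := Finset.sum_le_card_nsmul (Finset.univ : Finset V)
      (fun j => if r i ≤ k ∧ k < r j then a i j else 0) l (by
        intro j _
        split_ifs with hij
        · exact ha i j (by rintro rfl; omega)
        · exact hl)
    simpa using this
  simpa [cutWeight] using Finset.sum_le_card_nsmul _ _ _ this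

/-- The upward pull on an agent is controlled by the flows through the cuts above it: by
type-symmetry the influence of higher agents on it is at most `K` times its influence on them. -/
lemma IsRanking.inflow_le (h : IsRanking x r z) {a : V → V → ℝ} {K : ℝ}
    (ha : ∀ i j, 0 ≤ a i j) (hK : ∀ i j, a i j ≤ K * a j i) (hK0 : 0 ≤ K) (i : V) :
    inflow a x i ≤ K * ∑ k ∈ Finset.range (r i), cutFlow a r z k := by
  have h1 : ∀ j, max (x j - x i) 0 =
      ∑ k ∈ Finset.range (r i), if r j ≤ k then z k - z (k + 1) else 0 := by
    intro j
    rw [← Finset.sum_filter]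
    have hf : (Finset.range (r i)).filter (fun k => r j ≤ k) = Finset.Ico (r j) (r i) := by
      ext k
      simp [and_comm]
    rw [hf, h.val i, h.val j]
    rcases le_total (r j) (r i) with hji | hij
    · rw [max_eq_left (sub_nonneg.2 (h.anti hji))]
      have := Finset.sum_Ico_sub z hji
      rw [← neg_sub, ← this, ← Finset.sum_neg_distrib]
      exact Finset.sum_congr rfl fun k _ => by ring
    · rw [max_eq_right (sub_nonpos.2 (h.anti hij)), Finset.Ico_eq_empty_of_le hij,
        Finset.sum_empty]
  unfold inflow
  simp_rw [h1, Finset.mul_sum]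
  rw [Finset.sum_comm]
  refine Finset.sum_le_sum fun k hk => ?_
  rw [Finset.mem_range] at hk
  unfold cutFlow cutWeight
  rw [← mul_assoc, Finset.mul_sum, Finset.sum_mul]
  refine Finset.sum_le_sum fun j _ => ?_
  by_cases hj : r j ≤ k
  · rw [if_pos hj]
    refine mul_le_mul_of_nonneg_right ((hK i j).trans (mul_le_mul_of_nonneg_left ?_ hK0))
      (h.gap_nonneg k)
    refine le_trans ?_ (Finset.single_le_sum
      (f := fun m => if r j ≤ k ∧ k < r m then a j m else 0)
      (fun m _ => by split_ifs <;> simp [ha]) (Finset.mem_univ i))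
    simp [hj, hk]
  · simp [hj]

lemma IsRanking.cutFlow_le_outflow (h : IsRanking x r z) {a : V → V → ℝ}
    (ha : ∀ i j, 0 ≤ a i j) (k : ℕ) :
    cutFlow a r z k ≤ ∑ i ∈ topSet r k, outflow a x i := by
  unfold cutFlow cutWeight topSet outflow
  rw [Finset.sum_mul, Finset.sum_filter]
  refine Finset.sum_le_sum fun i _ => ?_
  split_ifs with hi
  · rw [Finset.sum_mul]
    refine Finset.sum_le_sum fun j _ => ?_
    split_ifs with hj
    · refine mul_le_mul_of_nonneg_left ?_ (ha i j)
      refine le_trans ?_ (le_max_left _ _)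
      rw [h.val i, h.val j]
      exact sub_le_sub (h.anti hi) (h.anti hj.2)
    · rw [zero_mul]
      exact mul_nonneg (ha i j) (le_max_right _ _)
  · simp [hi]

/-- The top set maximises the sum of the values among all sets of its size, and a different set
loses at least the gap. -/
lemma IsRanking.sum_add_gap_le (h : IsRanking x r z) {k : ℕ} {U : Finset V}
    (hU : U.card = (topSet r k).card) (hne : U ≠ topSet r k) :
    ∑ i ∈ U, x i + (z k - z (k + 1)) ≤ ∑ i ∈ topSet r k, x i := by
  classical
  set S := topSet r k with hS
  have hcard : (S \ U).card = (U \ S).card := Finset.card_sdiff_comm hU.symm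
  have hpos : 1 ≤ (S \ U).card := by
    rw [Nat.one_le_iff_ne_zero]
    intro h0
    rw [Finset.card_eq_zero, Finset.sdiff_eq_empty_iff_subset] at h0
    exact hne (Finset.eq_of_subset_of_card_le h0 hU.le).symm
  have h1 := Finset.sum_sdiff_sub_sum_sdiff (s₁ := U) (s₂ := S) (f := x)
  have h2 : (S \ U).card * z k ≤ ∑ i ∈ S \ U, x i := by
    rw [← nsmul_eq_mul]
    refine Finset.card_nsmul_le_sum _ _ _ fun i hi => ?_
    rw [h.val i]
    exact h.anti (by simpa [hS] using (Finset.mem_sdiff.1 hi).1)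
  have h3 : ∑ i ∈ U \ S, x i ≤ (S \ U).card * z (k + 1) := by
    rw [hcard, ← nsmul_eq_mul]
    refine Finset.sum_le_card_nsmul _ _ _ fun i hi => ?_
    rw [h.val i]
    have : ¬ r i ≤ k := by simpa [hS] using (Finset.mem_sdiff.1 hi).2
    exact h.anti (by omega)
  have h4 : z k - z (k + 1) ≤ (S \ U).card * (z k - z (k + 1)) :=
    le_mul_of_one_le_left (h.gap_nonneg k) (by exact_mod_cast hpos)
  linarith

lemma IsRanking.sum_le (h : IsRanking x r z) {k : ℕ} {U : Finset V}
    (hU : U.card = (topSet r k).card) : ∑ i ∈ U, x i ≤ ∑ i ∈ topSet r k, x i := by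
  by_cases hne : U = topSet r k
  · rw [hne]
  · linarith [h.sum_add_gap_le hU hne, h.gap_nonneg k]

end Ranking

/-! ### Summability of the flows -/

/-- Recurrent inequalities for the upper envelopes `X p i` of the agents: an envelope rises only
through the upward pull measured at the later index, an agent falls below its envelope (by `δ p i`)
through the downward pull, and such a fall persists in the envelope two steps later. The couplings
are type-symmetric and bounded. -/
structure IsEnvelopeSystem {V : Type*} [Fintype V] (α : ℕ → V → V → ℝ) (X δ : ℕ → V → ℝ)
    (K l C c m : ℝ) : Prop where
  K_nonneg : 0 ≤ K
  l_nonneg : 0 ≤ l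
  C_nonneg : 0 ≤ C
  c_pos : 0 < c
  nonneg : ∀ p i j, 0 ≤ α p i j
  symm : ∀ p i j, α p i j ≤ K * α p j i
  le : ∀ p i j, i ≠ j → α p i j ≤ l
  lower : ∀ p i, m ≤ X p i
  defect_nonneg : ∀ p i, 0 ≤ δ p i
  rise : ∀ p i, X (p + 1) i ≤ X p i + C * inflow (α (p + 1)) (X (p + 1)) i
  defect : ∀ p i, c * outflow (α p) (X p) i ≤ δ p i + C * inflow (α p) (X p) i
  fall : ∀ p i, X (p + 2) i ≤ X p i - c * δ p i +
    C * (inflow (α (p + 1)) (X (p + 1)) i + inflow (α (p + 2)) (X (p + 2)) i)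

section Envelope

variable {V : Type*} [Fintype V] {α : ℕ → V → V → ℝ} {X δ : ℕ → V → ℝ} {K l C c m : ℝ}
  {r : ℕ → V → ℕ} {z : ℕ → ℕ → ℝ}

lemma IsEnvelopeSystem.inflow_le_of_rank_le (hs : IsEnvelopeSystem α X δ K l C c m)
    (hr : ∀ p, IsRanking (X p) (r p) (z p)) {k p : ℕ} {i : V} (hi : r p i ≤ k) :
    inflow (α p) (X p) i ≤ K * ∑ j ∈ Finset.range k, cutFlow (α p) (r p) (z p) j :=
  ((hr p).inflow_le (hs.nonneg p) (hs.symm p) hs.K_nonneg i).trans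
    (mul_le_mul_of_nonneg_left (Finset.sum_le_sum_of_subset_of_nonneg
      (Finset.range_mono hi) fun j _ _ => (hr p).cutFlow_nonneg (hs.nonneg p) j) hs.K_nonneg)

lemma IsEnvelopeSystem.sum_inflow_le (hs : IsEnvelopeSystem α X δ K l C c m)
    (hr : ∀ p, IsRanking (X p) (r p) (z p)) (k p : ℕ) :
    C * ∑ i ∈ topSet (r p) k, inflow (α p) (X p) i ≤
      C * (Fintype.card V * K) * ∑ j ∈ Finset.range k, cutFlow (α p) (r p) (z p) j := by
  rw [mul_assoc]
  refine mul_le_mul_of_nonneg_left ?_ hs.C_nonneg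
  have hQ : 0 ≤ K * ∑ j ∈ Finset.range k, cutFlow (α p) (r p) (z p) j :=
    mul_nonneg hs.K_nonneg (Finset.sum_nonneg fun j _ => (hr p).cutFlow_nonneg (hs.nonneg p) j)
  refine (Finset.sum_le_card_nsmul _ _ _ fun i hi =>
    hs.inflow_le_of_rank_le hr (mem_topSet.1 hi)).trans ?_
  rw [nsmul_eq_mul, mul_assoc]
  exact mul_le_mul_of_nonneg_right (by exact_mod_cast Finset.card_le_univ _) hQ

/-- The flow through the cut below rank `k` is paid for by the decrease of the sum of the `k + 1`
largest envelopes over two steps, up to the flows through the cuts above. If the set of these agents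
is the same at the three indices, the decrease comes from the persistence of the fall. If it
changes at the first step, the exchange costs at least the gap. If it changes only at the second
step, the exchange costs the next gap, which is comparable to the present one unless the gap was
closed from above, which is itself a decrease, or from below, by a flow through the same cut. -/
lemma IsEnvelopeSystem.exists_cutFlow_le (hs : IsEnvelopeSystem α X δ K l C c m)
    (hr : ∀ p, IsRanking (X p) (r p) (z p)) {k : ℕ} (hk : k + 1 < Fintype.card V) :
    ∃ M E : ℝ, ∃ G : ℕ → ℝ,
      (∀ p, 0 ≤ G p) ∧
      (∀ p, G p = ∑ i ∈ topSet (r p) k, X p i - ∑ i ∈ topSet (r (p + 1)) k, X (p + 1) i +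
        E * ∑ j ∈ Finset.range k, cutFlow (α (p + 1)) (r (p + 1)) (z (p + 1)) j) ∧
      ∀ p, cutFlow (α p) (r p) (z p) k ≤ M * (G p + G (p + 1) +
        (∑ j ∈ Finset.range k, cutFlow (α p) (r p) (z p) j +
          ∑ j ∈ Finset.range k, cutFlow (α (p + 1)) (r (p + 1)) (z (p + 1)) j)) := by
  set n : ℝ := (Fintype.card V : ℝ) with hn
  set E : ℝ := C * (n * K) with hE
  set Q : ℕ → ℝ := fun p => ∑ j ∈ Finset.range k, cutFlow (α p) (r p) (z p) j with hQdef
  set S : ℕ → Finset V := fun p => topSet (r p) k with hS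
  set T : ℕ → ℝ := fun p => ∑ i ∈ S p, X p i with hT
  set G : ℕ → ℝ := fun p => T p - T (p + 1) + E * Q (p + 1) with hG
  set g : ℕ → ℝ := fun p => z p k - z p (k + 1) with hg
  set H : ℝ := n * (n * l) with hH
  have hK := hs.K_nonneg
  have hC := hs.C_nonneg
  have hc := hs.c_pos
  have hl := hs.l_nonneg
  have hn0 : 0 ≤ n := Nat.cast_nonneg _
  have hE0 : 0 ≤ E := by positivity
  have hH0 : 0 ≤ H := by positivity
  have hQ : ∀ p, 0 ≤ Q p := fun p =>
    Finset.sum_nonneg fun j _ => (hr p).cutFlow_nonneg (hs.nonneg p) j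
  have hgap : ∀ p, 0 ≤ g p := fun p => (hr p).gap_nonneg k
  have hcard : ∀ p q, (S p).card = (S q).card := fun p q => by
    rw [(hr p).card_topSet hk, (hr q).card_topSet hk]
  have hq : ∀ p, cutFlow (α p) (r p) (z p) k ≤ H * g p := fun p =>
    (hr p).cutFlow_le hl (hs.le p) k
  have hR : ∀ p, C * ∑ i ∈ S p, inflow (α p) (X p) i ≤ E * Q p := fun p =>
    hs.sum_inflow_le hr k p
  have hstep : ∀ p, T (p + 1) ≤ ∑ i ∈ S (p + 1), X p i + E * Q (p + 1) := by
    intro p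
    have h1 : T (p + 1) ≤ ∑ i ∈ S (p + 1),
        (X p i + C * inflow (α (p + 1)) (X (p + 1)) i) :=
      Finset.sum_le_sum fun i _ => hs.rise p i
    rw [Finset.sum_add_distrib, ← Finset.mul_sum] at h1
    linarith [hR (p + 1)]
  have hG0 : ∀ p, 0 ≤ G p := fun p => by
    have := (hr p).sum_le (hcard (p + 1) p)
    have h2 := hstep p
    simp only [hG, hT, hS] at *
    linarith
  have hswap : ∀ p, S (p + 1) ≠ S p → g p ≤ G p := fun p hne => by
    have := (hr p).sum_add_gap_le (hcard (p + 1) p) hne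
    have h2 := hstep p
    simp only [hG, hT, hS, hg] at *
    linarith
  -- one constant for each of the three cases
  refine ⟨H + (1 / c ^ 2 + E / c) + (H * (1 + C * K * H) + H * (C * K)), E, G, hG0,
    fun p => rfl, fun p => ?_⟩
  have hcase : ∀ {M₁ : ℝ}, cutFlow (α p) (r p) (z p) k ≤
      M₁ * (G p + G (p + 1) + (Q p + Q (p + 1))) →
      M₁ ≤ H + (1 / c ^ 2 + E / c) + (H * (1 + C * K * H) + H * (C * K)) →
      cutFlow (α p) (r p) (z p) k ≤ (H + (1 / c ^ 2 + E / c) +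
        (H * (1 + C * K * H) + H * (C * K))) * (G p + G (p + 1) + (Q p + Q (p + 1))) := by
    intro M₁ h1 h2
    refine h1.trans (mul_le_mul_of_nonneg_right h2 ?_)
    linarith [hG0 p, hG0 (p + 1), hQ p, hQ (p + 1)]
  have hc1 : 0 ≤ 1 / c ^ 2 := by positivity
  have hc2 : 0 ≤ E / c := by positivity
  have hc3 : 0 ≤ H * (1 + C * K * H) := by positivity
  have hc4 : 0 ≤ H * (C * K) := by positivity
  have hsum0 := hG0 p
  have hsum1 := hG0 (p + 1)
  have hQ0 := hQ p
  have hQ1 := hQ (p + 1)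
  by_cases h01 : S (p + 1) = S p
  swap
  · refine hcase (M₁ := H) ?_ (by linarith)
    refine (hq p).trans (mul_le_mul_of_nonneg_left ?_ hH0)
    linarith [hswap p h01]
  by_cases h12 : S (p + 1 + 1) = S (p + 1)
  · refine hcase (M₁ := 1 / c ^ 2 + E / c) ?_ (by linarith)
    have hfall : T (p + 2) ≤ ∑ i ∈ S p, (X p i - c * δ p i +
        C * (inflow (α (p + 1)) (X (p + 1)) i + inflow (α (p + 2)) (X (p + 2)) i)) := by
      have : S (p + 2) = S p := h12.trans h01
      simp only [hT, this]
      exact Finset.sum_le_sum fun i _ => hs.fall p i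
    rw [Finset.sum_add_distrib, Finset.sum_sub_distrib, ← Finset.mul_sum, ← Finset.mul_sum,
      Finset.sum_add_distrib, mul_add] at hfall
    have hR1 : C * ∑ i ∈ S p, inflow (α (p + 1)) (X (p + 1)) i ≤ E * Q (p + 1) := by
      rw [← h01]; exact hR (p + 1)
    have hR2 : C * ∑ i ∈ S p, inflow (α (p + 2)) (X (p + 2)) i ≤ E * Q (p + 2) := by
      rw [← h01, ← h12]; exact hR (p + 2)
    have hdef : ∑ i ∈ S p, c * outflow (α p) (X p) i ≤
        ∑ i ∈ S p, (δ p i + C * inflow (α p) (X p) i) :=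
      Finset.sum_le_sum fun i _ => hs.defect p i
    rw [← Finset.mul_sum, Finset.sum_add_distrib, ← Finset.mul_sum] at hdef
    have hout := (hr p).cutFlow_le_outflow (hs.nonneg p) k
    have h1 : c * cutFlow (α p) (r p) (z p) k ≤ ∑ i ∈ S p, δ p i + E * Q p := by
      have := mul_le_mul_of_nonneg_left hout hc.le
      linarith [hR p]
    have h2 : c * ∑ i ∈ S p, δ p i ≤ G p + G (p + 1) := by
      have e1 : G p + G (p + 1) = T p - T (p + 2) + E * Q (p + 1) + E * Q (p + 2) := by
        simp only [hG]; ring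
      have e2 : T p = ∑ i ∈ S p, X p i := rfl
      linarith
    have h3 : c ^ 2 * cutFlow (α p) (r p) (z p) k ≤ G p + G (p + 1) + c * (E * Q p) := by
      have := mul_le_mul_of_nonneg_left h1 hc.le
      linarith
    have h4 : cutFlow (α p) (r p) (z p) k ≤
        1 / c ^ 2 * (G p + G (p + 1)) + E / c * Q p := by
      have := mul_le_mul_of_nonneg_left h3 hc1
      have e1 : 1 / c ^ 2 * (c ^ 2 * cutFlow (α p) (r p) (z p) k) =
          cutFlow (α p) (r p) (z p) k := by field_simp
      have e2 : 1 / c ^ 2 * (G p + G (p + 1) + c * (E * Q p)) =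
          1 / c ^ 2 * (G p + G (p + 1)) + E / c * Q p := by field_simp
      linarith
    have h5 : 1 / c ^ 2 * (G p + G (p + 1)) ≤
        1 / c ^ 2 * (G p + G (p + 1) + (Q p + Q (p + 1))) :=
      mul_le_mul_of_nonneg_left (by linarith) hc1
    have h6 : E / c * Q p ≤ E / c * (G p + G (p + 1) + (Q p + Q (p + 1))) :=
      mul_le_mul_of_nonneg_left (by linarith) hc2
    linarith
  · refine hcase (M₁ := H * (1 + C * K * H) + H * (C * K)) ?_ (by linarith)
    obtain ⟨a, ha⟩ := (hr (p + 1)).surj k (by omega)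
    obtain ⟨b, hb⟩ := (hr (p + 1)).surj (k + 1) hk
    have haS : a ∈ S p := by
      rw [← h01]; simp [hS, ha]
    have hbS : b ∉ S p := by
      rw [← h01]; simp [hS, hb]
    -- the lowest member of the top set falls at most as much as the whole sum, up to rises
    have hdrop : X p a - X (p + 1) a ≤ G p := by
      have h1 : X p a - X (p + 1) a + C * inflow (α (p + 1)) (X (p + 1)) a ≤
          ∑ i ∈ S p, (X p i - X (p + 1) i + C * inflow (α (p + 1)) (X (p + 1)) i) :=
        Finset.single_le_sum
          (f := fun i => X p i - X (p + 1) i + C * inflow (α (p + 1)) (X (p + 1)) i)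
          (fun i _ => by linarith [hs.rise p i]) haS
      rw [Finset.sum_add_distrib, Finset.sum_sub_distrib, ← Finset.mul_sum] at h1
      have h2 : C * ∑ i ∈ S p, inflow (α (p + 1)) (X (p + 1)) i ≤ E * Q (p + 1) := by
        rw [← h01]; exact hR (p + 1)
      have e1 : T p = ∑ i ∈ S p, X p i := rfl
      have e2 : T (p + 1) = ∑ i ∈ S p, X (p + 1) i := by rw [← h01]
      have h3 : 0 ≤ C * inflow (α (p + 1)) (X (p + 1)) a :=
        mul_nonneg hC (inflow_nonneg (hs.nonneg _) _ _)
      simp only [hG]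
      linarith
    have hrise : X (p + 1) b - X p b ≤ C * K * (Q (p + 1) + H * g (p + 1)) := by
      have h1 := hs.inflow_le_of_rank_le hr hb.le
      rw [Finset.sum_range_succ] at h1
      have h2 : inflow (α (p + 1)) (X (p + 1)) b ≤ K * (Q (p + 1) + H * g (p + 1)) :=
        h1.trans (mul_le_mul_of_nonneg_left (by linarith [hq (p + 1)]) hK)
      have h3 := mul_le_mul_of_nonneg_left h2 hC
      linarith [hs.rise p b]
    have hgp : g p ≤ X p a - X p b := by
      rw [(hr p).val a, (hr p).val b]
      refine sub_le_sub ((hr p).anti (by simpa [hS] using haS)) ((hr p).anti ?_)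
      have : ¬ r p b ≤ k := by simpa [hS] using hbS
      omega
    have hgp1 : X (p + 1) a - X (p + 1) b = g (p + 1) := by
      rw [(hr (p + 1)).val a, (hr (p + 1)).val b, ha, hb]
    have hsw : g (p + 1) ≤ G (p + 1) := hswap (p + 1) h12
    have h1 : g p ≤ G p + (1 + C * K * H) * g (p + 1) + C * K * Q (p + 1) := by
      linarith
    have h0 : 0 ≤ C * K * H := by positivity
    have h2 : g p ≤ (1 + C * K * H) * (G p + G (p + 1)) + C * K * Q (p + 1) := by
      have e1 := mul_le_mul_of_nonneg_left hsw (by linarith : 0 ≤ 1 + C * K * H)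
      have e2 := mul_nonneg h0 hsum0
      linarith
    have h3 := (hq p).trans (mul_le_mul_of_nonneg_left h2 hH0)
    have h5 : H * (1 + C * K * H) * (G p + G (p + 1)) ≤
        H * (1 + C * K * H) * (G p + G (p + 1) + (Q p + Q (p + 1))) :=
      mul_le_mul_of_nonneg_left (by linarith) hc3
    have h6 : H * (C * K) * Q (p + 1) ≤
        H * (C * K) * (G p + G (p + 1) + (Q p + Q (p + 1))) :=
      mul_le_mul_of_nonneg_left (by linarith) hc4
    linarith

lemma IsEnvelopeSystem.summable_cutFlow (hs : IsEnvelopeSystem α X δ K l C c m)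
    (hr : ∀ p, IsRanking (X p) (r p) (z p)) :
    ∀ k, k + 1 < Fintype.card V → Summable fun p => cutFlow (α p) (r p) (z p) k := by
  intro k
  induction k using Nat.strong_induction_on with
  | _ k ih =>
    intro hk
    obtain ⟨M, E, G, hG0, hG, hM⟩ := hs.exists_cutFlow_le hr hk
    set Q : ℕ → ℝ := fun p => ∑ j ∈ Finset.range k, cutFlow (α p) (r p) (z p) j with hQdef
    have hQs : Summable Q := summable_sum fun j hj => by
      rw [Finset.mem_range] at hj
      exact ih j hj (by omega)
    have hQs1 : Summable fun p => Q (p + 1) := (summable_nat_add_iff 1).2 hQs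
    set T : ℕ → ℝ := fun p => ∑ i ∈ topSet (r p) k, X p i with hT
    have hTm : ∀ p, ((k + 1 : ℕ) : ℝ) * m ≤ T p := fun p => by
      rw [← (hr p).card_topSet hk, ← nsmul_eq_mul]
      exact Finset.card_nsmul_le_sum _ _ _ fun i _ => hs.lower p i
    obtain ⟨B, hB⟩ := (hQs1.mul_left E).hasSum.tendsto_sum_nat.bddAbove_range
    have hGs : Summable G := by
      refine summable_of_sum_range_le (c := T 0 - ((k + 1 : ℕ) : ℝ) * m + B) hG0 fun N => ?_
      have : ∑ p ∈ Finset.range N, G p =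
          (T 0 - T N) + ∑ p ∈ Finset.range N, E * Q (p + 1) := by
        rw [← Finset.sum_range_sub', ← Finset.sum_add_distrib]
        exact Finset.sum_congr rfl fun p _ => hG p
      have hBN := hB ⟨N, rfl⟩
      simp only at hBN
      linarith [hTm N]
    have hGs1 : Summable fun p => G (p + 1) := (summable_nat_add_iff 1).2 hGs
    exact Summable.of_nonneg_of_le (fun p => (hr p).cutFlow_nonneg (hs.nonneg p) k) hM
      (((hGs.add hGs1).add (hQs.add hQs1)).mul_left M)

theorem IsEnvelopeSystem.summable_inflow (hs : IsEnvelopeSystem α X δ K l C c m) (i : V) :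
    Summable fun p => inflow (α p) (X p) i := by
  have : Nonempty V := ⟨i⟩
  choose r z hr using fun p => exists_isRanking (X p)
  have hn : 0 < Fintype.card V := Fintype.card_pos
  have hlt : ∀ p, r p i ≤ Fintype.card V - 1 := by
    intro p
    by_contra hcon
    have hsub : insert (r p i) (Finset.range (Fintype.card V)) ⊆
        (Finset.univ : Finset V).image (r p) := by
      intro k hk
      rw [Finset.mem_insert, Finset.mem_range] at hk
      rcases hk with rfl | hk
      · simp
      · obtain ⟨j, rfl⟩ := (hr p).surj k hk
        simp
    have h1 := Finset.card_le_card hsub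
    rw [Finset.card_insert_of_notMem (by simp; omega), Finset.card_range] at h1
    have h2 := Finset.card_image_le (s := (Finset.univ : Finset V)) (f := r p)
    rw [Finset.card_univ] at h2
    omega
  refine Summable.of_nonneg_of_le (fun p => inflow_nonneg (hs.nonneg p) _ _)
    (fun p => hs.inflow_le_of_rank_le hr (hlt p)) (Summable.mul_left K (summable_sum ?_))
  intro k hk
  rw [Finset.mem_range] at hk
  exact hs.summable_cutFlow hr k (by omega)

lemma IsEnvelopeSystem.summable_defect (hs : IsEnvelopeSystem α X δ K l C c m) (i : V) :
    Summable fun p => δ p i := by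
  have hR := hs.summable_inflow i
  have hR1 := (summable_nat_add_iff 1).2 hR
  have hR2 := (summable_nat_add_iff 2).2 hR
  have hS := (hR1.add hR2).mul_left C
  obtain ⟨B, hB⟩ := hS.hasSum.tendsto_sum_nat.bddAbove_range
  have hcδ : Summable fun p => c * δ p i := by
    refine summable_of_sum_range_le (c := X 0 i + X 1 i - 2 * m + B)
      (fun p => mul_nonneg hs.c_pos.le (hs.defect_nonneg p i)) fun N => ?_
    have h1 : ∑ p ∈ Finset.range N, c * δ p i ≤ ∑ p ∈ Finset.range N,
        (((X p i + X (p + 1) i) - (X (p + 1) i + X (p + 1 + 1) i)) +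
          C * (inflow (α (p + 1)) (X (p + 1)) i + inflow (α (p + 2)) (X (p + 2)) i)) :=
      Finset.sum_le_sum fun p _ => by linarith [hs.fall p i]
    rw [Finset.sum_add_distrib,
      Finset.sum_range_sub' (fun p => X p i + X (p + 1) i)] at h1
    have h2 := hB ⟨N, rfl⟩
    simp only at h2
    linarith [hs.lower N i, hs.lower (N + 1) i]
  simpa [hs.c_pos.ne'] using hcδ.mul_left c⁻¹

lemma IsEnvelopeSystem.tendsto (hs : IsEnvelopeSystem α X δ K l C c m) (i : V) :
    ∃ y, Tendsto (fun p => X p i) atTop (𝓝 y) := by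
  have hR1 := ((summable_nat_add_iff 1).2 (hs.summable_inflow i)).mul_left C
  set s : ℕ → ℝ := fun N => ∑ p ∈ Finset.range N, C * inflow (α (p + 1)) (X (p + 1)) i with hsdef
  have hst : Tendsto s atTop (𝓝 _) := hR1.hasSum.tendsto_sum_nat
  obtain ⟨B, hB⟩ := hst.bddAbove_range
  -- subtracting the accumulated rises makes the envelope nonincreasing
  have hanti : Antitone fun p => X p i - s p := by
    refine antitone_nat_of_succ_le fun p => ?_
    have : s (p + 1) = s p + C * inflow (α (p + 1)) (X (p + 1)) i := Finset.sum_range_succ _ _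
    linarith [hs.rise p i]
  have hbdd : BddBelow (Set.range fun p => X p i - s p) := by
    refine ⟨m - B, ?_⟩
    rintro _ ⟨p, rfl⟩
    have := hB ⟨p, rfl⟩
    simp only at this ⊢
    linarith [hs.lower p i]
  exact ⟨_, by simpa using (tendsto_atTop_ciInf hanti hbdd).add hst⟩

/-- The couplings between two agents with distinct limiting envelopes are summable. -/
lemma IsEnvelopeSystem.summable_coupling (hs : IsEnvelopeSystem α X δ K l C c m) {i j : V}
    {y w : ℝ} (hi : Tendsto (fun p => X p i) atTop (𝓝 y))
    (hj : Tendsto (fun p => X p j) atTop (𝓝 w)) (hyw : y < w) :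
    Summable fun p => α p i j := by
  have hd : ∀ᶠ p in atTop, (w - y) / 2 < X p j - X p i :=
    (hj.sub hi).eventually (lt_mem_nhds (by linarith))
  have h0 : 0 < (w - y) / 2 := by linarith
  refine summable_of_isBigO_nat (hs.summable_inflow i) (Asymptotics.IsBigO.of_bound
    ((w - y) / 2)⁻¹ ?_)
  filter_upwards [hd] with p hp
  rw [Real.norm_of_nonneg (hs.nonneg p i j),
    Real.norm_of_nonneg (inflow_nonneg (hs.nonneg p) _ _), ← div_eq_inv_mul, le_div_iff₀ h0]
  refine le_trans ?_ (Finset.single_le_sum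
    (f := fun j => α p i j * max (X p j - X p i) 0)
    (fun k _ => mul_nonneg (hs.nonneg p i k) (le_max_right _ _)) (Finset.mem_univ j))
  exact mul_le_mul_of_nonneg_left (hp.le.trans (le_max_left _ _)) (hs.nonneg p i j)

end Envelope

/-! ### A comparison estimate -/

lemma _root_.AbsolutelyContinuousOnInterval.lipschitz_comp {f g : ℝ → ℝ} {a b : ℝ} {K : NNReal}
    (hf : AbsolutelyContinuousOnInterval f a b) (hg : LipschitzOnWith K g (f '' Set.uIcc a b)) :
    AbsolutelyContinuousOnInterval (fun t => g (f t)) a b := by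
  rw [absolutelyContinuousOnInterval_iff] at hf ⊢
  intro ε hε
  obtain ⟨d, hd, hfd⟩ := hf (ε / (K + 1)) (by positivity)
  refine ⟨d, hd, fun E hE hlen => ?_⟩
  have h1 := hfd E hE hlen
  rw [lt_div_iff₀ (by positivity)] at h1
  have h0 : 0 ≤ ∑ i ∈ Finset.range E.1, dist (f (E.2 i).1) (f (E.2 i).2) :=
    Finset.sum_nonneg fun _ _ => dist_nonneg
  have h2 : ∑ i ∈ Finset.range E.1, dist (g (f (E.2 i).1)) (g (f (E.2 i).2)) ≤
      K * ∑ i ∈ Finset.range E.1, dist (f (E.2 i).1) (f (E.2 i).2) := by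
    rw [Finset.mul_sum]
    exact Finset.sum_le_sum fun i hi => hg.dist_le_mul _ (Set.mem_image_of_mem f (hE.1 i hi).1) _
      (Set.mem_image_of_mem f (hE.1 i hi).2)
  nlinarith

lemma _root_.AbsolutelyContinuousOnInterval.exp {f : ℝ → ℝ} {a b : ℝ}
    (hf : AbsolutelyContinuousOnInterval f a b) :
    AbsolutelyContinuousOnInterval (fun t => Real.exp (f t)) a b := by
  obtain ⟨R, hR⟩ := hf.exists_bound
  obtain ⟨K, hK⟩ := (Real.contDiff_exp (n := 1)).contDiffOn.exists_lipschitzOnWith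
    (by decide) (convex_Icc (-R) R) isCompact_Icc
  refine hf.lipschitz_comp (hK.mono ?_)
  rintro _ ⟨t, ht, rfl⟩
  exact abs_le.1 (hR t ht)

lemma _root_.AbsolutelyContinuousOnInterval.sub_le_integral {f g : ℝ → ℝ} {a b : ℝ} (hab : a ≤ b)
    (hf : AbsolutelyContinuousOnInterval f a b) (hg : IntervalIntegrable g volume a b)
    (hfg : ∀ᵐ t, t ∈ Set.Icc a b → deriv f t ≤ g t) :
    f b - f a ≤ ∫ t in a..b, g t := by
  rw [← hf.integral_deriv_eq_sub]
  refine intervalIntegral.integral_mono_ae_restrict hab hf.intervalIntegrable_deriv hg ?_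
  exact (ae_restrict_iff' measurableSet_Icc).2 hfg

/-- If `x` is pulled with weights `a j` towards targets not exceeding `b j`, and `x s ≤ B`, then
`x t` keeps at least the fraction `exp (-L)` of the distance from `B`, up to the pull towards targets
above `B`; targets below `B` contribute a further decrease. The estimate is the variation of
constants formula for `x - B`, in which the kernel lies between `exp (-L)` and `1`. -/
lemma le_of_weighted_pull {ι : Type*} {J : Finset ι} {x : ℝ → ℝ} {a : ι → ℝ → ℝ} {b : ι → ℝ}
    {s t B L : ℝ} (hst : s ≤ t) (hx : AbsolutelyContinuousOnInterval x s t)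
    (ha : ∀ j ∈ J, IntervalIntegrable (a j) volume s t)
    (ha0 : ∀ j ∈ J, ∀ r ∈ Set.Icc s t, 0 ≤ a j r)
    (hd : ∀ᵐ r, r ∈ Set.Icc s t → ∃ v, HasDerivAt x v r ∧ v ≤ ∑ j ∈ J, a j r * (b j - x r))
    (hL : ∑ j ∈ J, ∫ r in s..t, a j r ≤ L) (hB : x s ≤ B) :
    x t ≤ B - Real.exp (-L) * (B - x s) + ∑ j ∈ J, (∫ r in s..t, a j r) * max (b j - B) 0
      - Real.exp (-L) * ∑ j ∈ J, (∫ r in s..t, a j r) * max (B - b j) 0 := by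
  set w : ℝ → ℝ := fun r => ∑ j ∈ J, a j r with hw
  have hwi : IntervalIntegrable w volume s t := by
    have hsum : w = ∑ j ∈ J, a j := by
      ext r
      simp [hw]
    rw [hsum]
    exact IntervalIntegrable.sum J ha
  have hw0 : ∀ r ∈ Set.Icc s t, 0 ≤ w r := fun r hr => Finset.sum_nonneg fun j hj => ha0 j hj r hr
  set W : ℝ → ℝ := fun r => ∫ v in s..r, w v with hW
  have hWac : AbsolutelyContinuousOnInterval W s t :=
    hwi.absolutelyContinuousOnInterval_intervalIntegral Set.left_mem_uIcc
  have hWs : W s = 0 := intervalIntegral.integral_same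
  have hWt : W t = ∑ j ∈ J, ∫ r in s..t, a j r := by
    simp only [hW, hw]
    exact intervalIntegral.integral_finsetSum ha
  have hWpos : ∀ r ∈ Set.Icc s t, 0 ≤ W r := fun r hr =>
    intervalIntegral.integral_nonneg hr.1 fun v hv => hw0 v ⟨hv.1, hv.2.trans hr.2⟩
  have hWle : ∀ r ∈ Set.Icc s t, W r ≤ W t := fun r hr => by
    refine intervalIntegral.integral_mono_interval le_rfl hr.1 hr.2 ?_ hwi
    exact (ae_restrict_iff' measurableSet_Ioc).2 (ae_of_all _ fun v hv => hw0 v ⟨hv.1.le, hv.2⟩)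
  have hWd : ∀ᵐ r, r ∈ Set.Icc s t → HasDerivAt W (w r) r := by
    filter_upwards [hwi.ae_hasDerivAt_integral] with r hr hrm
    exact hr (by rwa [Set.uIcc_of_le hst]) s Set.left_mem_uIcc
  set P : ℝ := ∑ j ∈ J, (∫ r in s..t, a j r) * max (b j - B) 0 with hP
  set N : ℝ := ∑ j ∈ J, (∫ r in s..t, a j r) * max (B - b j) 0 with hN
  have hα : ∀ j ∈ J, 0 ≤ ∫ r in s..t, a j r := fun j hj =>
    intervalIntegral.integral_nonneg hst (ha0 j hj)
  have hN0 : 0 ≤ N := Finset.sum_nonneg fun j hj => mul_nonneg (hα j hj) (le_max_right _ _)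
  set f : ℝ → ℝ := fun r => Real.exp (W r) * (x r - B) with hf
  have hfac : AbsolutelyContinuousOnInterval f s t :=
    hWac.exp.mul (hx.sub (contDiffOn_const (c := B)).absolutelyContinuousOnInterval)
  set g : ℝ → ℝ := fun r => ∑ j ∈ J,
    a j r * (Real.exp (W t) * max (b j - B) 0 - max (B - b j) 0) with hg
  have hgj : ∀ j ∈ J, IntervalIntegrable
      (fun r => a j r * (Real.exp (W t) * max (b j - B) 0 - max (B - b j) 0)) volume s t :=
    fun j hj => (ha j hj).mul_const _
  have hgi : IntervalIntegrable g volume s t := by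
    have hsum : g = ∑ j ∈ J, fun r =>
        a j r * (Real.exp (W t) * max (b j - B) 0 - max (B - b j) 0) := by
      ext r
      simp [hg]
    rw [hsum]
    exact IntervalIntegrable.sum J hgj
  have hgint : ∫ r in s..t, g r = Real.exp (W t) * P - N := by
    simp only [hg]
    rw [intervalIntegral.integral_finsetSum hgj]
    simp only [intervalIntegral.integral_mul_const, hP, hN, Finset.mul_sum]
    rw [← Finset.sum_sub_distrib]
    exact Finset.sum_congr rfl fun j _ => by ring
  have hfg : ∀ᵐ r, r ∈ Set.Icc s t → deriv f r ≤ g r := by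
    filter_upwards [hWd, hd] with r hr1 hr2 hr
    obtain ⟨v, hv, hvle⟩ := hr2 hr
    have hder : HasDerivAt f (Real.exp (W r) * w r * (x r - B) + Real.exp (W r) * v) r :=
      (hr1 hr).exp.mul (hv.sub_const B)
    rw [hder.deriv]
    have h1 : Real.exp (W r) * w r * (x r - B) + Real.exp (W r) * v ≤
        Real.exp (W r) * ∑ j ∈ J, a j r * (b j - B) := by
      have e1 : ∑ j ∈ J, a j r * (b j - B) =
          w r * (x r - B) + ∑ j ∈ J, a j r * (b j - x r) := by
        simp only [hw, Finset.sum_mul]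
        rw [← Finset.sum_add_distrib]
        exact Finset.sum_congr rfl fun j _ => by ring
      rw [e1, mul_add, mul_assoc]
      exact add_le_add_right (mul_le_mul_of_nonneg_left hvle (Real.exp_pos _).le) _
    refine h1.trans ?_
    rw [Finset.mul_sum]
    refine Finset.sum_le_sum fun j hj => ?_
    have h2 : Real.exp (W r) * (b j - B) ≤
        Real.exp (W t) * max (b j - B) 0 - max (B - b j) 0 := by
      have e1 : 1 ≤ Real.exp (W r) := Real.one_le_exp (hWpos r hr)
      have e2 : Real.exp (W r) ≤ Real.exp (W t) := Real.exp_le_exp.2 (hWle r hr)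
      rcases le_total (b j) B with hbB | hbB
      · rw [max_eq_right (by linarith), max_eq_left (by linarith)]
        nlinarith
      · rw [max_eq_left (by linarith), max_eq_right (by linarith)]
        nlinarith
    have := mul_le_mul_of_nonneg_left h2 (ha0 j hj r hr)
    linarith
  have hmain := hfac.sub_le_integral hst hgi hfg
  rw [hgint] at hmain
  simp only [hf, hWs, Real.exp_zero, one_mul] at hmain
  have hmul := mul_le_mul_of_nonneg_left hmain (Real.exp_pos (-W t)).le
  have hinv : Real.exp (-W t) * Real.exp (W t) = 1 := by rw [← Real.exp_add]; simp
  have hLt : Real.exp (-L) ≤ Real.exp (-W t) := Real.exp_le_exp.2 (by linarith)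
  have e1 : Real.exp (-W t) * (Real.exp (W t) * (x t - B) - (x s - B)) =
      (x t - B) + Real.exp (-W t) * (B - x s) := by linear_combination (x t - B) * hinv
  have e2 : Real.exp (-W t) * (Real.exp (W t) * P - N) = P - Real.exp (-W t) * N := by
    linear_combination P * hinv
  rw [e1, e2] at hmul
  have e3 := mul_le_mul_of_nonneg_right hLt (sub_nonneg.2 hB)
  have e4 := mul_le_mul_of_nonneg_right hLt hN0
  linarith

/-! ### Upper envelopes of a solution -/

section Windows

variable {V : Type*} {hbar tstar : ℝ} {A : ℝ → Matrix V V ℝ} {h : V → V → ℝ → ℝ} {τ : ℕ → ℝ}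
  {K l : ℝ}

lemma IsAdmissible.intervalIntegrable (hadm : IsAdmissible hbar A h) (i j : V) {s t : ℝ}
    (hs : 0 ≤ s) (ht : 0 ≤ t) : IntervalIntegrable (fun r => A r i j) volume s t := by
  refine ((hadm.weight_locallyIntegrable i j).integrableOn_compact_subset ?_
    isCompact_uIcc).intervalIntegrable
  exact fun r hr => (le_min hs ht).trans hr.1

/-- Largest value of agent `i` on the window `[τ p, τ (p + 1)]` and the `hbar` units of time
before it, that is, the largest value which can enter the equations on this window. -/
noncomputable def upperEnvelope (hbar : ℝ) (τ : ℕ → ℝ) (x : ℝ → V → ℝ) (p : ℕ) (i : V) : ℝ :=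
  sSup ((fun t => x t i) '' Set.Icc (τ p - hbar) (τ (p + 1)))

/-- Integrals of the weights over the window `[τ p, τ (p + 1)]`. -/
noncomputable def windowWeight (A : ℝ → Matrix V V ℝ) (τ : ℕ → ℝ) (p : ℕ) (i j : V) : ℝ :=
  ∫ t in (τ p)..(τ (p + 1)), A t i j

/-- Windows at least as long as the largest delay, beginning after one delay has elapsed, on which
the integrated weights are bounded and type-symmetric. -/
structure IsWindowing (hbar : ℝ) (A : ℝ → Matrix V V ℝ) (tstar : ℝ) (τ : ℕ → ℝ) (K l : ℝ) :
    Prop where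
  start : tstar + hbar ≤ τ 0
  length : ∀ p, τ p + hbar ≤ τ (p + 1)
  tendsto : Tendsto τ atTop atTop
  K_nonneg : 0 ≤ K
  l_nonneg : 0 ≤ l
  symm : ∀ p i j, windowWeight A τ p i j ≤ K * windowWeight A τ p j i
  le : ∀ p i j, i ≠ j → windowWeight A τ p i j ≤ l

lemma IsWindowing.monotone (hadm : IsAdmissible hbar A h) (hτ : IsWindowing hbar A tstar τ K l) :
    Monotone τ :=
  monotone_nat_of_le_succ fun p => by linarith [hτ.length p, hadm.hbar_nonneg]

lemma IsWindowing.start_le (hadm : IsAdmissible hbar A h) (hτ : IsWindowing hbar A tstar τ K l)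
    (p : ℕ) : tstar ≤ τ p - hbar := by
  linarith [hτ.start, hτ.monotone hadm (Nat.zero_le p)]

lemma IsWindowing.windowWeight_nonneg (hadm : IsAdmissible hbar A h) (h0 : 0 ≤ tstar)
    (hτ : IsWindowing hbar A tstar τ K l) (p : ℕ) (i j : V) : 0 ≤ windowWeight A τ p i j :=
  intervalIntegral.integral_nonneg (hτ.monotone hadm (Nat.le_succ p)) fun t ht =>
    hadm.weight_nonneg t (by linarith [ht.1, hτ.start_le hadm p, hadm.hbar_nonneg]) i j

lemma IsAdmissible.integral_le_windowWeight (hadm : IsAdmissible hbar A h)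
    (hτ : IsWindowing hbar A tstar τ K l) (h0 : 0 ≤ tstar) (p : ℕ) (i j : V) {s t : ℝ}
    (hs : τ p ≤ s) (hst : s ≤ t) (ht : t ≤ τ (p + 1)) :
    ∫ r in s..t, A r i j ≤ windowWeight A τ p i j := by
  have hτ0 : 0 ≤ τ p := by linarith [hτ.start_le hadm p, hadm.hbar_nonneg]
  refine intervalIntegral.integral_mono_interval hs hst ht ?_
    (hadm.intervalIntegrable i j hτ0 (hτ0.trans (hs.trans (hst.trans ht))))
  exact (ae_restrict_iff' measurableSet_Ioc).2
    (ae_of_all _ fun r hr => hadm.weight_nonneg r (hτ0.trans hr.1.le) i j)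

/-- A lower bound for the fraction of the distance to an upper bound which is kept over a window. -/
noncomputable def retention (V : Type*) [Fintype V] (l : ℝ) : ℝ :=
  Real.exp (-(Fintype.card V * l))

lemma retention_pos [Fintype V] : 0 < retention V l := Real.exp_pos _

lemma IsWindowing.retention_le_one [Fintype V] (hτ : IsWindowing hbar A tstar τ K l) : retention V l ≤ 1 :=
  Real.exp_le_one_iff.2 (neg_nonpos.2 (mul_nonneg (Nat.cast_nonneg _) hτ.l_nonneg))

lemma IsWindowing.exists_mem_Icc (hτ : IsWindowing hbar A tstar τ K l) {N : ℕ} {t : ℝ}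
    (ht : τ N ≤ t) : ∃ p, N ≤ p ∧ t ∈ Set.Icc (τ p) (τ (p + 1)) := by
  classical
  have hex : ∃ q, N ≤ q ∧ t < τ q :=
    ((eventually_ge_atTop N).and (hτ.tendsto.eventually_gt_atTop t)).exists
  obtain ⟨hq1, hq2⟩ := Nat.find_spec hex
  have hne : Nat.find hex ≠ N := fun heq => by
    rw [heq] at hq2
    linarith
  obtain ⟨p, hp⟩ : ∃ p, Nat.find hex = p + 1 := ⟨Nat.find hex - 1, by omega⟩
  have hmin := Nat.find_min hex (m := p) (by omega)
  have hNp : N ≤ p := by omega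
  rw [hp] at hq2
  exact ⟨p, hNp, not_lt.1 fun hlt => hmin ⟨hNp, hlt⟩, hq2.le⟩

end Windows

section Solution

variable {V : Type*} [Fintype V] [DecidableEq V] {hbar tstar : ℝ} {A : ℝ → Matrix V V ℝ}
  {h : V → V → ℝ → ℝ} {x : ℝ → V → ℝ} {τ : ℕ → ℝ} {K l : ℝ}

lemma IsSolution.const_sub (hx : IsSolution hbar A h tstar x) (c : ℝ) :
    IsSolution hbar A h tstar (fun t i => c - x t i) where
  start_nonneg := hx.start_nonneg
  history i := (memLp_const c).sub (hx.history i)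
  absolutelyContinuous i T hT :=
    (contDiffOn_const (c := c)).absolutelyContinuousOnInterval.sub (hx.absolutelyContinuous i T hT)
  equation i := by
    filter_upwards [hx.equation i] with t ht
    refine (ht.const_sub c).congr_deriv ?_
    rw [← Finset.sum_neg_distrib]
    exact Finset.sum_congr rfl fun j _ => by ring

lemma IsSolution.absolutelyContinuous_Icc (hx : IsSolution hbar A h tstar x) (i : V) {s t : ℝ}
    (hs : tstar ≤ s) (hst : s ≤ t) : AbsolutelyContinuousOnInterval (fun r => x r i) s t := by
  refine (hx.absolutelyContinuous i t (hs.trans hst)).mono ?_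
  rw [Set.uIcc_of_le hst, Set.uIcc_of_le (hs.trans hst)]
  exact Set.Icc_subset_Icc_left hs

/-- The comparison estimate for one agent, when `b` bounds all the delayed values which enter its
equation on `[s, t]`. -/
lemma IsSolution.le_of_delayed_le (hadm : IsAdmissible hbar A h)
    (hx : IsSolution hbar A h tstar x) {s t B L : ℝ} {b : V → ℝ} (i : V)
    (hs : tstar ≤ s) (hst : s ≤ t) (hb : ∀ j, ∀ r ∈ Set.Icc (s - hbar) t, x r j ≤ b j)
    (hL : ∑ j ∈ Finset.univ.erase i, ∫ r in s..t, A r i j ≤ L) (hB : x s i ≤ B) :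
    x t i ≤ B - Real.exp (-L) * (B - x s i) +
      ∑ j ∈ Finset.univ.erase i, (∫ r in s..t, A r i j) * max (b j - B) 0 -
      Real.exp (-L) * ∑ j ∈ Finset.univ.erase i, (∫ r in s..t, A r i j) * max (B - b j) 0 := by
  have hs0 : 0 ≤ s := hx.start_nonneg.trans hs
  refine le_of_weighted_pull (x := fun r => x r i) (a := fun j r => A r i j) hst
    (hx.absolutelyContinuous_Icc i hs hst)
    (fun j _ => hadm.intervalIntegrable i j hs0 (hs0.trans hst))
    (fun j _ r hr => hadm.weight_nonneg r (hs0.trans hr.1) i j) ?_ hL hB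
  filter_upwards [(ae_restrict_iff' measurableSet_Ici).1 (hx.equation i)] with r hr hrI
  refine ⟨_, hr (hs.trans hrI.1), Finset.sum_le_sum fun j hj => ?_⟩
  have hd := hadm.delay_mem i j (Finset.ne_of_mem_erase hj).symm r (hs0.trans hrI.1)
  have := hb j (r - h i j r) ⟨by linarith [hrI.1, hd.2], by linarith [hrI.2, hd.1]⟩
  exact mul_le_mul_of_nonneg_left (by linarith) (hadm.weight_nonneg r (hs0.trans hrI.1) i j)

lemma IsSolution.isCompact_image (hadm : IsAdmissible hbar A h)
    (hx : IsSolution hbar A h tstar x) (hτ : IsWindowing hbar A tstar τ K l) (p : ℕ) (i : V) :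
    IsCompact ((fun t => x t i) '' Set.Icc (τ p - hbar) (τ (p + 1))) := by
  have h1 := hτ.start_le hadm p
  have h2 : τ p - hbar ≤ τ (p + 1) := by linarith [hτ.length p, hadm.hbar_nonneg]
  have hc := (hx.absolutelyContinuous_Icc i h1 h2).continuousOn
  rw [Set.uIcc_of_le h2] at hc
  exact isCompact_Icc.image_of_continuousOn hc

lemma IsSolution.le_upperEnvelope (hadm : IsAdmissible hbar A h)
    (hx : IsSolution hbar A h tstar x) (hτ : IsWindowing hbar A tstar τ K l) (p : ℕ) (i : V)
    {t : ℝ} (ht : t ∈ Set.Icc (τ p - hbar) (τ (p + 1))) : x t i ≤ upperEnvelope hbar τ x p i :=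
  le_csSup (hx.isCompact_image hadm hτ p i).bddAbove (Set.mem_image_of_mem _ ht)

lemma IsSolution.exists_eq_upperEnvelope (hadm : IsAdmissible hbar A h)
    (hx : IsSolution hbar A h tstar x) (hτ : IsWindowing hbar A tstar τ K l) (p : ℕ) (i : V) :
    ∃ t ∈ Set.Icc (τ p - hbar) (τ (p + 1)), x t i = upperEnvelope hbar τ x p i := by
  have h2 : τ p - hbar ≤ τ (p + 1) := by linarith [hτ.length p, hadm.hbar_nonneg]
  exact (hx.isCompact_image hadm hτ p i).sSup_mem ((Set.nonempty_Icc.2 h2).image _)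

lemma IsAdmissible.sum_integral_le (hadm : IsAdmissible hbar A h)
    (hτ : IsWindowing hbar A tstar τ K l) (h0 : 0 ≤ tstar) (p : ℕ) (i : V) {s t : ℝ}
    (hs : τ p ≤ s) (hst : s ≤ t) (ht : t ≤ τ (p + 1)) :
    ∑ j ∈ Finset.univ.erase i, ∫ r in s..t, A r i j ≤ Fintype.card V * l := by
  refine (Finset.sum_le_card_nsmul _ _ l fun j hj => ?_).trans ?_
  · exact (hadm.integral_le_windowWeight hτ h0 p i j hs hst ht).trans
      (hτ.le p i j (Finset.ne_of_mem_erase hj).symm)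
  · rw [nsmul_eq_mul]
    exact mul_le_mul_of_nonneg_right (by exact_mod_cast Finset.card_le_univ _) hτ.l_nonneg

/-- The comparison estimate within one window, in terms of the envelopes. -/
lemma IsSolution.le_on_window (hadm : IsAdmissible hbar A h)
    (hx : IsSolution hbar A h tstar x) (hτ : IsWindowing hbar A tstar τ K l) (p : ℕ) (i : V)
    {s t B : ℝ} (hs : τ p ≤ s) (hst : s ≤ t) (ht : t ≤ τ (p + 1))
    (hB : upperEnvelope hbar τ x p i ≤ B) :
    x t i ≤ B - retention V l * (B - x s i) +
      inflow (windowWeight A τ p) (upperEnvelope hbar τ x p) i := by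
  set X := upperEnvelope hbar τ x p with hX
  have h0 := hx.start_nonneg
  have hb0 := hadm.hbar_nonneg
  have h1 := hτ.start_le hadm p
  have hs0 : 0 ≤ s := by linarith
  have hw : ∀ j, ∫ r in s..t, A r i j ≤ windowWeight A τ p i j := fun j =>
    hadm.integral_le_windowWeight hτ h0 p i j hs hst ht
  have hpos : ∀ j, 0 ≤ ∫ r in s..t, A r i j := fun j =>
    intervalIntegral.integral_nonneg hst fun r hr => hadm.weight_nonneg r (hs0.trans hr.1) i j
  have hxs : x s i ≤ B :=
    (hx.le_upperEnvelope hadm hτ p i ⟨by linarith, hst.trans ht⟩).trans hB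
  have hmain := hx.le_of_delayed_le hadm (B := B) (L := Fintype.card V * l) (b := X) i
    (by linarith) hst
    (fun j r hr => hx.le_upperEnvelope hadm hτ p j ⟨by linarith [hr.1], hr.2.trans ht⟩)
    (hadm.sum_integral_le hτ h0 p i hs hst ht) hxs
  have hin : ∑ j ∈ Finset.univ.erase i, (∫ r in s..t, A r i j) * max (X j - B) 0 ≤
      inflow (windowWeight A τ p) X i := by
    unfold inflow
    refine (Finset.sum_le_sum fun j _ => ?_).trans
      (Finset.sum_le_sum_of_subset_of_nonneg (Finset.erase_subset i Finset.univ)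
        fun j _ _ => mul_nonneg (hτ.windowWeight_nonneg hadm h0 p i j) (le_max_right _ _))
    exact mul_le_mul (hw j) (max_le_max_right 0 (by linarith)) (le_max_right _ _)
      (hτ.windowWeight_nonneg hadm h0 p i j)
  have hout : 0 ≤ Real.exp (-(Fintype.card V * l)) *
      ∑ j ∈ Finset.univ.erase i, (∫ r in s..t, A r i j) * max (B - X j) 0 :=
    mul_nonneg (Real.exp_pos _).le
      (Finset.sum_nonneg fun j _ => mul_nonneg (hpos j) (le_max_right _ _))
  unfold retention
  linarith

/-- By the end of a window the downward pull has been felt. -/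
lemma IsSolution.le_end_of_window (hadm : IsAdmissible hbar A h)
    (hx : IsSolution hbar A h tstar x) (hτ : IsWindowing hbar A tstar τ K l) (p : ℕ) (i : V) :
    x (τ (p + 1)) i ≤ upperEnvelope hbar τ x p i +
      inflow (windowWeight A τ p) (upperEnvelope hbar τ x p) i -
      retention V l * outflow (windowWeight A τ p) (upperEnvelope hbar τ x p) i := by
  set X := upperEnvelope hbar τ x p with hX
  have h0 := hx.start_nonneg
  have hb0 := hadm.hbar_nonneg
  have h1 := hτ.start_le hadm p
  have hst : τ p ≤ τ (p + 1) := hτ.monotone hadm (Nat.le_succ p)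
  have hxs : x (τ p) i ≤ X i := hx.le_upperEnvelope hadm hτ p i ⟨by linarith, hst⟩
  have hmain := hx.le_of_delayed_le hadm (B := X i) (L := Fintype.card V * l) (b := X) i
    (by linarith) hst (fun j r hr => hx.le_upperEnvelope hadm hτ p j hr)
    (hadm.sum_integral_le hτ h0 p i le_rfl hst le_rfl) hxs
  have e1 : ∑ j ∈ Finset.univ.erase i, (∫ r in (τ p)..(τ (p + 1)), A r i j) *
      max (X j - X i) 0 = inflow (windowWeight A τ p) X i := by
    unfold inflow
    rw [← Finset.add_sum_erase _ _ (Finset.mem_univ i)]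
    simp [windowWeight]
  have e2 : ∑ j ∈ Finset.univ.erase i, (∫ r in (τ p)..(τ (p + 1)), A r i j) *
      max (X i - X j) 0 = outflow (windowWeight A τ p) X i := by
    unfold outflow
    rw [← Finset.add_sum_erase _ _ (Finset.mem_univ i)]
    simp [windowWeight]
  rw [e1, e2] at hmain
  have h2 : 0 ≤ Real.exp (-(Fintype.card V * l)) * (X i - x (τ p) i) :=
    mul_nonneg (Real.exp_pos _).le (by linarith)
  unfold retention
  linarith

lemma IsSolution.upperEnvelope_succ_le (hadm : IsAdmissible hbar A h)
    (hx : IsSolution hbar A h tstar x) (hτ : IsWindowing hbar A tstar τ K l) (p : ℕ) (i : V) :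
    upperEnvelope hbar τ x (p + 1) i ≤ upperEnvelope hbar τ x p i + (retention V l)⁻¹ *
      inflow (windowWeight A τ (p + 1)) (upperEnvelope hbar τ x (p + 1)) i := by
  have h0 := hx.start_nonneg
  have hb0 := hadm.hbar_nonneg
  have hγ : 0 < retention V l := retention_pos
  have hR : 0 ≤ inflow (windowWeight A τ (p + 1)) (upperEnvelope hbar τ x (p + 1)) i :=
    inflow_nonneg (hτ.windowWeight_nonneg hadm h0 (p + 1)) _ _
  have hR' := mul_nonneg (inv_pos.2 hγ).le hR
  obtain ⟨t, ht, hxt⟩ := hx.exists_eq_upperEnvelope hadm hτ (p + 1) i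
  have hl := hτ.length p
  rcases le_total t (τ (p + 1)) with htp | htp
  · have := hx.le_upperEnvelope hadm hτ p i (t := t) ⟨by linarith [ht.1], htp⟩
    linarith
  · have h1 := hx.le_on_window hadm hτ (p + 1) i le_rfl htp ht.2 le_rfl
    have h2 := hx.le_upperEnvelope hadm hτ p i (t := τ (p + 1)) ⟨by linarith, le_rfl⟩
    rw [hxt] at h1
    have h3 : retention V l * (upperEnvelope hbar τ x (p + 1) i - x (τ (p + 1)) i) ≤
        inflow (windowWeight A τ (p + 1)) (upperEnvelope hbar τ x (p + 1)) i := by linarith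
    have h4 := mul_le_mul_of_nonneg_left h3 (inv_pos.2 hγ).le
    rw [inv_mul_cancel_left₀ hγ.ne'] at h4
    linarith

/-- Solutions are bounded above: the agent with the largest envelope is not pulled upwards. -/
lemma IsSolution.exists_forall_le (hadm : IsAdmissible hbar A h)
    (hx : IsSolution hbar A h tstar x) (hτ : IsWindowing hbar A tstar τ K l) :
    ∃ M, ∀ p i, upperEnvelope hbar τ x p i ≤ M := by
  rcases isEmpty_or_nonempty V with hV | hV
  · exact ⟨0, fun p i => hV.elim i⟩
  obtain ⟨i₀, hi₀⟩ := Finite.exists_max (upperEnvelope hbar τ x 0)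
  refine ⟨upperEnvelope hbar τ x 0 i₀, fun p => ?_⟩
  induction p with
  | zero => exact hi₀
  | succ p ih =>
    intro i
    obtain ⟨k, hk⟩ := Finite.exists_max (upperEnvelope hbar τ x (p + 1))
    have h1 := hx.upperEnvelope_succ_le hadm hτ p k
    have h2 : inflow (windowWeight A τ (p + 1)) (upperEnvelope hbar τ x (p + 1)) k = 0 :=
      Finset.sum_eq_zero fun j _ => by rw [max_eq_right (sub_nonpos.2 (hk j)), mul_zero]
    rw [h2, mul_zero, add_zero] at h1
    exact (hk i).trans (h1.trans (ih k))

lemma IsSolution.exists_forall_ge (hadm : IsAdmissible hbar A h)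
    (hx : IsSolution hbar A h tstar x) (hτ : IsWindowing hbar A tstar τ K l) :
    ∃ m, ∀ p i, m ≤ upperEnvelope hbar τ x p i := by
  obtain ⟨M, hM⟩ := (hx.const_sub 0).exists_forall_le hadm hτ
  refine ⟨-M, fun p i => ?_⟩
  have hmem : τ p ∈ Set.Icc (τ p - hbar) (τ (p + 1)) :=
    ⟨by linarith [hadm.hbar_nonneg], hτ.monotone hadm (Nat.le_succ p)⟩
  have h1 := (hx.const_sub 0).le_upperEnvelope hadm hτ p i hmem
  have h2 := hx.le_upperEnvelope hadm hτ p i hmem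
  linarith [hM p i]

lemma IsSolution.isEnvelopeSystem (hadm : IsAdmissible hbar A h)
    (hx : IsSolution hbar A h tstar x) (hτ : IsWindowing hbar A tstar τ K l) :
    ∃ m, IsEnvelopeSystem (windowWeight A τ) (upperEnvelope hbar τ x)
      (fun p i => upperEnvelope hbar τ x p i - x (τ (p + 1)) i) K l ((retention V l)⁻¹ + 1)
      (retention V l ^ 2) m := by
  obtain ⟨m, hm⟩ := hx.exists_forall_ge hadm hτ
  have h0 := hx.start_nonneg
  have hb0 := hadm.hbar_nonneg
  have hγ : 0 < retention V l := retention_pos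
  have hγ1 : retention V l ≤ 1 := hτ.retention_le_one
  have hinv : 0 < (retention V l)⁻¹ := inv_pos.2 hγ
  have hw := hτ.windowWeight_nonneg hadm h0
  set X := upperEnvelope hbar τ x with hX
  set R : ℕ → V → ℝ := fun p => inflow (windowWeight A τ p) (X p) with hRdef
  have hR : ∀ p i, 0 ≤ R p i := fun p i => inflow_nonneg (hw p) _ _
  have hδ : ∀ p i, 0 ≤ X p i - x (τ (p + 1)) i := fun p i => sub_nonneg.2 <|
    hx.le_upperEnvelope hadm hτ p i ⟨by linarith [hτ.length p], le_rfl⟩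
  have hrise : ∀ p i, X (p + 1) i ≤ X p i + (retention V l)⁻¹ * R (p + 1) i :=
    hx.upperEnvelope_succ_le hadm hτ
  refine ⟨m, hτ.K_nonneg, hτ.l_nonneg, by positivity, by positivity, hw, hτ.symm, hτ.le, hm, hδ,
    fun p i => ?_, fun p i => ?_, fun p i => ?_⟩
  · linarith [hrise p i, hR (p + 1) i]
  · have h1 := hx.le_end_of_window hadm hτ p i
    have h2 : retention V l ^ 2 * outflow (windowWeight A τ p) (X p) i ≤
        retention V l * outflow (windowWeight A τ p) (X p) i :=
      mul_le_mul_of_nonneg_right (by nlinarith) (outflow_nonneg (hw p) _ _)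
    have h3 := mul_nonneg hinv.le (hR p i)
    simp only [hRdef] at h3
    linarith
  · set γ := retention V l with hγdef
    set δ := X p i - x (τ (p + 1)) i with hδdef
    have hδ0 : 0 ≤ δ := hδ p i
    have hR1 := hR (p + 1) i
    have hR2 := hR (p + 2) i
    have hR1' := mul_nonneg hinv.le hR1
    have hR2' := mul_nonneg hinv.le hR2
    change X (p + 2) i ≤ X p i - γ ^ 2 * δ + (γ⁻¹ + 1) * (R (p + 1) i + R (p + 2) i)
    -- `B` bounds the envelopes at `p` and at `p + 1`
    set B := max (X p i) (X (p + 1) i) with hB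
    have hBle : B ≤ X p i + γ⁻¹ * R (p + 1) i :=
      max_le (by linarith) (hrise p i)
    have hBδ : δ ≤ B - x (τ (p + 1)) i := sub_le_sub_right (le_max_left _ _) _
    have hfirst : ∀ t, τ (p + 1) ≤ t → t ≤ τ (p + 2) → x t i ≤ B - γ * δ + R (p + 1) i := by
      intro t h1 h2
      have h3 := hx.le_on_window hadm hτ (p + 1) i le_rfl h1 h2 (le_max_right (X p i) _)
      have h4 := mul_le_mul_of_nonneg_left hBδ hγ.le
      simp only [hRdef]
      linarith
    have hsq : γ ^ 2 * δ ≤ γ * δ := mul_le_mul_of_nonneg_right (by nlinarith) hδ0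
    have hl1 := hτ.length (p + 1)
    obtain ⟨t, ht, hxt⟩ := hx.exists_eq_upperEnvelope hadm hτ (p + 2) i
    rw [← hX] at hxt
    rcases le_total t (τ (p + 2)) with htp | htp
    · have := hfirst t (by linarith [ht.1]) htp
      linarith
    · set B' := max B (X (p + 2) i) with hB'
      have hB'le : B' ≤ B + γ⁻¹ * R (p + 2) i :=
        max_le (by linarith) ((hrise (p + 1) i).trans
          (by linarith [le_max_right (X p i) (X (p + 1) i)]))
      have h1 := hx.le_on_window hadm hτ (p + 2) i le_rfl htp ht.2 (le_max_right B _)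
      have h2 := hfirst (τ (p + 2)) (hτ.monotone hadm (Nat.le_succ _)) le_rfl
      have h3 : γ * δ - R (p + 1) i ≤ B' - x (τ (p + 2)) i := by
        linarith [le_max_left B (X (p + 2) i)]
      have h4 := mul_le_mul_of_nonneg_left h3 hγ.le
      have h5 : γ * R (p + 1) i ≤ R (p + 1) i := mul_le_of_le_one_left hR1 hγ1
      rw [hxt] at h1
      simp only [← hB', ← hX] at h1
      have h6 : γ * (γ * δ - R (p + 1) i) = γ ^ 2 * δ - γ * R (p + 1) i := by ring
      change X (p + 2) i ≤ B' - γ * (B' - x (τ (p + 2)) i) + R (p + 2) i at h1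
      linarith

/-- A solution and its upper envelopes have the same limits. -/
lemma IsSolution.exists_tendsto (hadm : IsAdmissible hbar A h)
    (hx : IsSolution hbar A h tstar x) (hτ : IsWindowing hbar A tstar τ K l) (i : V) :
    ∃ y, Tendsto (fun p => upperEnvelope hbar τ x p i) atTop (𝓝 y) ∧
      Tendsto (fun t => x t i) atTop (𝓝 y) := by
  obtain ⟨m, hs⟩ := hx.isEnvelopeSystem hadm hτ
  obtain ⟨y, hy⟩ := hs.tendsto i
  refine ⟨y, hy, ?_⟩
  have hγ : 0 < retention V l := retention_pos
  have hb0 := hadm.hbar_nonneg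
  have herr := ((hs.summable_defect i).add (hs.summable_inflow i)).tendsto_atTop_zero.const_mul
    (retention V l)⁻¹
  rw [mul_zero] at herr
  rw [Metric.tendsto_atTop]
  intro ε hε
  obtain ⟨N, hN⟩ := eventually_atTop.1 ((Metric.tendsto_nhds.1 hy (ε / 2) (by linarith)).and
    (herr.eventually (gt_mem_nhds (half_pos hε))))
  refine ⟨τ N, fun t ht => ?_⟩
  obtain ⟨p, hNp, htp⟩ := hτ.exists_mem_Icc ht
  obtain ⟨h1, h2⟩ := hN p hNp
  have h3 := hx.le_upperEnvelope hadm hτ p i (t := t) ⟨by linarith [htp.1], htp.2⟩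
  have h4 := hx.le_on_window hadm hτ p i htp.1 htp.2 le_rfl le_rfl
  have h5 : retention V l * (upperEnvelope hbar τ x p i - x t i) ≤
      upperEnvelope hbar τ x p i - x (τ (p + 1)) i +
        inflow (windowWeight A τ p) (upperEnvelope hbar τ x p) i := by linarith
  have h6 := mul_le_mul_of_nonneg_left h5 (inv_pos.2 hγ).le
  rw [inv_mul_cancel_left₀ hγ.ne'] at h6
  rw [Real.dist_eq, abs_lt] at h1 ⊢
  constructor <;> linarith [h1.1, h1.2]

end Solution

/-! ### Merging short windows -/

lemma exists_coarsening {σ : ℕ → ℝ} (hσ : Tendsto σ atTop atTop) (T : ℝ)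
    {hbar : ℝ} (hb : 0 ≤ hbar) : ∃ φ : ℕ → ℕ, StrictMono φ ∧ T ≤ σ (φ 0) ∧
      ∀ k, σ (φ k) + hbar ≤ σ (φ (k + 1)) ∧ σ (φ (k + 1) - 1) ≤ σ (φ k) + hbar := by
  classical
  have hnext : ∀ m, ∃ q, m < q ∧ σ m + hbar ≤ σ q ∧ σ (q - 1) ≤ σ m + hbar := by
    intro m
    have hex : ∃ q, m < q ∧ σ m + hbar ≤ σ q :=
      ((eventually_gt_atTop m).and (hσ.eventually_ge_atTop (σ m + hbar))).exists
    obtain ⟨h1, h2⟩ := Nat.find_spec hex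
    refine ⟨Nat.find hex, h1, h2, ?_⟩
    rcases Nat.eq_or_lt_of_le (Nat.le_sub_one_of_lt h1) with heq | hlt
    · rw [← heq]
      linarith
    · have hmin := Nat.find_min hex (m := Nat.find hex - 1) (by omega)
      by_contra hcon
      exact hmin ⟨hlt, by linarith⟩
  choose next h1 h2 h3 using hnext
  obtain ⟨m₀, hm₀⟩ := (hσ.eventually_ge_atTop T).exists
  let φ : ℕ → ℕ := fun k => Nat.rec m₀ (fun _ m => next m) k
  exact ⟨φ, strictMono_nat_of_lt_succ fun k => h1 (φ k), hm₀, fun k => ⟨h2 (φ k), h3 (φ k)⟩⟩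

/-- Merging consecutive windows until their length reaches `hbar` preserves type-symmetry, and it
preserves boundedness by uniform local summability: all but the last of the merged windows have
total length at most `hbar`. -/
lemma exists_isWindowing {V : Type*} {hbar : ℝ} {A : ℝ → Matrix V V ℝ} {h : V → V → ℝ → ℝ}
    (hadm : IsAdmissible hbar A h) (hnits : IsNITS A) (hsum : UniformlyLocallySummable A)
    (tstar : ℝ) : ∃ τ K l, IsWindowing hbar A tstar τ K l := by
  obtain ⟨σ, K, hσ0, hσm, hσt, hK, hsym, ℓ, hℓ⟩ := hnits
  have hb0 := hadm.hbar_nonneg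
  obtain ⟨μ, hμ⟩ := hsum (hbar + 1) (by linarith)
  obtain ⟨φ, hφm, hφ0, hφ⟩ := exists_coarsening hσt (tstar + hbar) hb0
  have hσpos : ∀ p, 0 ≤ σ p := fun p => hσ0.trans (hσm.monotone (Nat.zero_le p))
  have hint : ∀ i j p q, IntervalIntegrable (fun t => A t i j) volume (σ p) (σ q) :=
    fun i j p q => hadm.intervalIntegrable i j (hσpos p) (hσpos q)
  have hadj : ∀ i j {p q : ℕ}, p ≤ q → ∑ k ∈ Finset.Ico p q,
      ∫ t in (σ k)..(σ (k + 1)), A t i j = ∫ t in (σ p)..(σ q), A t i j := fun i j p q hpq =>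
    intervalIntegral.sum_integral_adjacent_intervals_Ico hpq fun k _ => hint i j k (k + 1)
  refine ⟨fun p => σ (φ p), K, max (μ + ℓ) 0, hφ0, fun p => (hφ p).1,
    hσt.comp hφm.tendsto_atTop, by linarith, le_max_right _ _, fun p i j => ?_,
    fun p i j hij => ?_⟩
  · have hle : φ p ≤ φ (p + 1) := (hφm (Nat.lt_succ_self p)).le
    unfold windowWeight
    rw [← hadj i j hle, ← hadj j i hle, Finset.mul_sum]
    exact Finset.sum_le_sum fun k _ => (hsym k i j).2
  · refine le_trans ?_ (le_max_left _ _)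
    have hlt : φ p < φ (p + 1) := hφm (Nat.lt_succ_self p)
    obtain ⟨q, hq⟩ : ∃ q, φ (p + 1) = q + 1 := ⟨φ (p + 1) - 1, by omega⟩
    have hpq : φ p ≤ q := by omega
    have h2 := (hφ p).2
    rw [hq, Nat.add_sub_cancel] at h2
    have h1 : ∫ t in (σ (φ p))..(σ q), A t i j ≤ μ := by
      refine le_trans ?_ (hμ (σ (φ p)) (hσpos _) i j)
      have hpos := hσpos (φ p)
      refine intervalIntegral.integral_mono_interval le_rfl (hσm.monotone hpq) (by linarith) ?_
        (hadm.intervalIntegrable i j hpos (by linarith))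
      exact (ae_restrict_iff' measurableSet_Ioc).2
        (ae_of_all _ fun r hr => hadm.weight_nonneg r (hpos.trans hr.1.le) i j)
    change ∫ t in (σ (φ p))..(σ (φ (p + 1))), A t i j ≤ μ + ℓ
    rw [hq, ← intervalIntegral.integral_add_adjacent_intervals (hint i j _ q) (hint i j q _)]
    exact add_le_add h1 (hℓ q i j hij)

/-! ### Existence of solutions with constant history -/

lemma _root_.IntervalIntegrable.mul_unit_bounded {f u : ℝ → ℝ} {a b : ℝ}
    (hf : IntervalIntegrable f volume a b) (hu : AEMeasurable u volume)
    (hu1 : ∀ t, u t ∈ Set.Icc (0 : ℝ) 1) :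
    IntervalIntegrable (fun t => f t * u t) volume a b := by
  refine hf.norm.mono_fun' (hf.aestronglyMeasurable_restrict_uIoc.mul
    hu.aestronglyMeasurable.restrict) (ae_of_all _ fun t => ?_)
  dsimp only
  rw [norm_mul, Real.norm_of_nonneg (hu1 t).1]
  exact mul_le_of_le_one_right (norm_nonneg _) (hu1 t).2

lemma locallyIntegrable_of_intervalIntegrable {f : ℝ → ℝ}
    (hf : ∀ a b, IntervalIntegrable f volume a b) : LocallyIntegrable f volume := fun t =>
  ⟨Set.Icc (t - 1) (t + 1), Icc_mem_nhds (by linarith) (by linarith),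
    (intervalIntegrable_iff_integrableOn_Icc_of_le (by linarith)).1 (hf (t - 1) (t + 1))⟩

section Picard

variable {V : Type*} [Fintype V]

/-- Integral of the total weight of agent `i` from `s` to `t`. -/
noncomputable def totalWeight (b : V → V → ℝ → ℝ) (s : ℝ) (i : V) (t : ℝ) : ℝ :=
  ∫ r in s..t, ∑ j, b i j r

/-- Integrand of the variation of constants formula for
`y_i' = ∑ j, b_ij (y_j ∘ θ_ij - y_i)`. -/
noncomputable def picardIntegrand (b θ : V → V → ℝ → ℝ) (s : ℝ) (y : ℝ → V → ℝ) (i : V)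
    (r : ℝ) : ℝ :=
  Real.exp (totalWeight b s i r) * ∑ j, b i j r * y (θ i j r) j

/-- The variation of constants operator, whose fixed points solve
`y_i' = ∑ j, b_ij (y_j ∘ θ_ij - y_i)` with initial value `y0`. Unlike the plain integral operator
it is monotone in `y`. -/
noncomputable def picard (b θ : V → V → ℝ → ℝ) (s : ℝ) (y0 : V → ℝ) (y : ℝ → V → ℝ) (t : ℝ)
    (i : V) : ℝ :=
  Real.exp (-totalWeight b s i t) * (y0 i + ∫ r in s..t, picardIntegrand b θ s y i r)

/-- Admissible data for the monotone iteration: weights which vanish up to the initial time `s`,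
measurable deviated arguments, initial values between `0` and `1`. -/
structure IsPicardData (b θ : V → V → ℝ → ℝ) (s : ℝ) (y0 : V → ℝ) : Prop where
  integrable : ∀ i j u v, IntervalIntegrable (b i j) volume u v
  nonneg : ∀ i j r, 0 ≤ b i j r
  vanish : ∀ i j r, r ≤ s → b i j r = 0
  measurable : ∀ i j, AEMeasurable (θ i j) volume
  init : ∀ i, y0 i ∈ Set.Icc (0 : ℝ) 1

variable {b θ : V → V → ℝ → ℝ} {s : ℝ} {y0 : V → ℝ} {y y' : ℝ → V → ℝ}

lemma IsPicardData.integrable_sum (hd : IsPicardData b θ s y0) (i : V) (u v : ℝ) :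
    IntervalIntegrable (fun r => ∑ j, b i j r) volume u v := by
  have hsum : (fun r => ∑ j, b i j r) = ∑ j, b i j := by
    ext r
    simp
  rw [hsum]
  exact IntervalIntegrable.sum _ fun j _ => hd.integrable i j u v

lemma IsPicardData.continuous_totalWeight (hd : IsPicardData b θ s y0) (i : V) :
    Continuous (totalWeight b s i) :=
  intervalIntegral.continuous_primitive (hd.integrable_sum i) s

lemma IsPicardData.integrable_picardIntegrand (hd : IsPicardData b θ s y0)
    (hym : ∀ j, Measurable fun t => y t j) (hy : ∀ t j, y t j ∈ Set.Icc (0 : ℝ) 1) (i : V)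
    (u v : ℝ) : IntervalIntegrable (picardIntegrand b θ s y i) volume u v := by
  have hsum : (fun r => ∑ j, b i j r * y (θ i j r) j) =
      ∑ j, fun r => b i j r * y (θ i j r) j := by
    ext r
    simp
  have h1 : IntervalIntegrable (fun r => ∑ j, b i j r * y (θ i j r) j) volume u v := by
    rw [hsum]
    exact IntervalIntegrable.sum _ fun j _ => (hd.integrable i j u v).mul_unit_bounded
      ((hym j).comp_aemeasurable (hd.measurable i j)) fun t => hy _ j
  exact h1.continuousOn_mul (Real.continuous_exp.comp (hd.continuous_totalWeight i)).continuousOn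

lemma IsPicardData.picardIntegrand_vanish (hd : IsPicardData b θ s y0) (i : V) {r : ℝ}
    (hr : r ≤ s) : picardIntegrand b θ s y i r = 0 := by
  simp [picardIntegrand, hd.vanish i _ r hr]

lemma IsPicardData.picard_of_le (hd : IsPicardData b θ s y0) {t : ℝ} (ht : t ≤ s) (i : V) :
    picard b θ s y0 y t i = y0 i := by
  have h1 : totalWeight b s i t = 0 := by
    refine intervalIntegral.integral_zero_ae (ae_of_all _ fun r hr => ?_)
    rw [Set.uIoc_of_ge ht] at hr
    exact Finset.sum_eq_zero fun j _ => hd.vanish i j r hr.2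
  have h2 : ∫ r in s..t, picardIntegrand b θ s y i r = 0 := by
    refine intervalIntegral.integral_zero_ae (ae_of_all _ fun r hr => ?_)
    rw [Set.uIoc_of_ge ht] at hr
    exact hd.picardIntegrand_vanish i hr.2
  simp [picard, h1, h2]

lemma IsPicardData.continuous_picard (hd : IsPicardData b θ s y0)
    (hym : ∀ j, Measurable fun t => y t j) (hy : ∀ t j, y t j ∈ Set.Icc (0 : ℝ) 1) (i : V) :
    Continuous fun t => picard b θ s y0 y t i :=
  (Real.continuous_exp.comp (hd.continuous_totalWeight i).neg).mul (continuous_const.add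
    (intervalIntegral.continuous_primitive (hd.integrable_picardIntegrand hym hy i) s))

lemma IsPicardData.picardIntegrand_mono (hd : IsPicardData b θ s y0) (h : ∀ t j, y t j ≤ y' t j)
    (i : V) (r : ℝ) : picardIntegrand b θ s y i r ≤ picardIntegrand b θ s y' i r :=
  mul_le_mul_of_nonneg_left (Finset.sum_le_sum fun j _ =>
    mul_le_mul_of_nonneg_left (h _ j) (hd.nonneg i j r)) (Real.exp_pos _).le

lemma IsPicardData.picard_mono (hd : IsPicardData b θ s y0)
    (hym : ∀ j, Measurable fun t => y t j) (hy : ∀ t j, y t j ∈ Set.Icc (0 : ℝ) 1)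
    (hym' : ∀ j, Measurable fun t => y' t j) (hy' : ∀ t j, y' t j ∈ Set.Icc (0 : ℝ) 1)
    (h : ∀ t j, y t j ≤ y' t j) (t : ℝ) (i : V) :
    picard b θ s y0 y t i ≤ picard b θ s y0 y' t i := by
  rcases le_total t s with ht | ht
  · rw [hd.picard_of_le ht, hd.picard_of_le ht]
  · refine mul_le_mul_of_nonneg_left (add_le_add_right ?_ _) (Real.exp_pos _).le
    exact intervalIntegral.integral_mono_on ht (hd.integrable_picardIntegrand hym hy i s t)
      (hd.integrable_picardIntegrand hym' hy' i s t) fun r _ => hd.picardIntegrand_mono h i r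

lemma IsPicardData.absolutelyContinuous_totalWeight (hd : IsPicardData b θ s y0) (i : V) (T : ℝ) :
    AbsolutelyContinuousOnInterval (totalWeight b s i) s T :=
  (hd.integrable_sum i s T).absolutelyContinuousOnInterval_intervalIntegral Set.left_mem_uIcc

lemma IsPicardData.hasDerivAt_totalWeight (hd : IsPicardData b θ s y0) (i : V) :
    ∀ᵐ t, HasDerivAt (totalWeight b s i) (∑ j, b i j t) t := by
  filter_upwards [_root_.LocallyIntegrable.ae_hasDerivAt_integral
    (locallyIntegrable_of_intervalIntegrable (hd.integrable_sum i))] with t ht using ht s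

lemma IsPicardData.picard_one_le (hd : IsPicardData b θ s y0) (t : ℝ) (i : V) :
    picard b θ s y0 (fun _ _ => 1) t i ≤ 1 := by
  have h1 : ∫ r in s..t, picardIntegrand b θ s (fun _ _ => 1) i r =
      Real.exp (totalWeight b s i t) - 1 := by
    have h2 := (hd.absolutelyContinuous_totalWeight i t).exp.integral_deriv_eq_sub
    have h3 : totalWeight b s i s = 0 := intervalIntegral.integral_same
    rw [h3, Real.exp_zero] at h2
    rw [← h2]
    refine intervalIntegral.integral_congr_ae ?_
    filter_upwards [hd.hasDerivAt_totalWeight i] with r hr _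
    simp [picardIntegrand, hr.exp.deriv]
  have h4 : Real.exp (-totalWeight b s i t) * Real.exp (totalWeight b s i t) = 1 := by
    rw [← Real.exp_add]
    simp
  have h5 : picard b θ s y0 (fun _ _ => 1) t i =
      1 - Real.exp (-totalWeight b s i t) * (1 - y0 i) := by
    unfold picard
    rw [h1]
    linear_combination h4
  have h6 : 0 ≤ Real.exp (-totalWeight b s i t) * (1 - y0 i) :=
    mul_nonneg (Real.exp_pos _).le (sub_nonneg.2 (hd.init i).2)
  linarith

lemma IsPicardData.picard_mem_Icc (hd : IsPicardData b θ s y0)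
    (hym : ∀ j, Measurable fun t => y t j) (hy : ∀ t j, y t j ∈ Set.Icc (0 : ℝ) 1) (t : ℝ) (i : V) :
    picard b θ s y0 y t i ∈ Set.Icc (0 : ℝ) 1 := by
  constructor
  · rcases le_total t s with ht | ht
    · rw [hd.picard_of_le ht]
      exact (hd.init i).1
    · refine mul_nonneg (Real.exp_pos _).le (add_nonneg (hd.init i).1 ?_)
      exact intervalIntegral.integral_nonneg ht fun r _ => mul_nonneg (Real.exp_pos _).le
        (Finset.sum_nonneg fun j _ => mul_nonneg (hd.nonneg i j r) (hy _ j).1)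
  · refine (hd.picard_mono hym hy (fun _ => measurable_const) ?_ (fun t j => (hy t j).2) t i).trans
      (hd.picard_one_le t i)
    exact fun _ _ => ⟨zero_le_one, le_rfl⟩

/-- The iteration from `0` increases to a fixed point of the variation of constants operator. -/
lemma IsPicardData.exists_fixedPoint (hd : IsPicardData b θ s y0) :
    ∃ y : ℝ → V → ℝ, (∀ j, Measurable fun t => y t j) ∧ (∀ t j, y t j ∈ Set.Icc (0 : ℝ) 1) ∧
      ∀ t i, picard b θ s y0 y t i = y t i := by
  set Y : ℕ → ℝ → V → ℝ := fun k => (picard b θ s y0)^[k] (fun _ _ => 0) with hY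
  have hYs : ∀ k, Y (k + 1) = picard b θ s y0 (Y k) := fun k =>
    Function.iterate_succ_apply' _ _ _
  have hall : ∀ k, (∀ j, Measurable fun t => Y k t j) ∧
      (∀ t j, Y k t j ∈ Set.Icc (0 : ℝ) 1) := by
    intro k
    induction k with
    | zero => exact ⟨fun _ => measurable_const, fun _ _ => ⟨le_rfl, zero_le_one⟩⟩
    | succ k ih =>
      rw [hYs]
      exact ⟨fun j => (hd.continuous_picard ih.1 ih.2 j).measurable,
        fun t j => hd.picard_mem_Icc ih.1 ih.2 t j⟩
  have hmono : ∀ k t j, Y k t j ≤ Y (k + 1) t j := by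
    intro k
    induction k with
    | zero => exact fun t j => ((hall 1).2 t j).1
    | succ k ih =>
      intro t j
      rw [hYs (k + 1), hYs k]
      refine hd.picard_mono (hall k).1 (hall k).2 ?_ ?_ ?_ t j
      · rw [← hYs]; exact (hall (k + 1)).1
      · rw [← hYs]; exact (hall (k + 1)).2
      · rw [← hYs]; exact ih
  set y : ℝ → V → ℝ := fun t j => ⨆ k, Y k t j with hy
  have hlim : ∀ t j, Tendsto (fun k => Y k t j) atTop (𝓝 (y t j)) := fun t j =>
    tendsto_atTop_ciSup (monotone_nat_of_le_succ fun k => hmono k t j)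
      ⟨1, by rintro _ ⟨k, rfl⟩; exact ((hall k).2 t j).2⟩
  refine ⟨y, fun j => ?_, fun t j => ?_, fun t i => ?_⟩
  · exact measurable_of_tendsto_metrizable (fun k => (hall k).1 j)
      (tendsto_pi_nhds.2 fun t => hlim t j)
  · exact isClosed_Icc.mem_of_tendsto (hlim t j) (Eventually.of_forall fun k => (hall k).2 t j)
  · refine tendsto_nhds_unique ?_ ((tendsto_add_atTop_iff_nat 1).2 (hlim t i))
    simp only [hYs]
    refine Tendsto.const_mul _ (Tendsto.const_add _ ?_)
    refine intervalIntegral.tendsto_integral_filter_of_dominated_convergence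
      (picardIntegrand b θ s (fun _ _ => 1) i)
      (Eventually.of_forall fun k => ?_) (Eventually.of_forall fun k => ae_of_all _ fun r _ => ?_)
      (hd.integrable_picardIntegrand (fun _ => measurable_const)
        (fun _ _ => ⟨zero_le_one, le_rfl⟩) i s t) (ae_of_all _ fun r _ => ?_)
    · exact (hd.integrable_picardIntegrand (hall k).1 (hall k).2 i s
        t).aestronglyMeasurable_restrict_uIoc
    · rw [Real.norm_of_nonneg]
      · exact hd.picardIntegrand_mono (fun t j => ((hall k).2 t j).2) i r
      · exact mul_nonneg (Real.exp_pos _).le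
          (Finset.sum_nonneg fun j _ => mul_nonneg (hd.nonneg i j r) ((hall k).2 _ j).1)
    · exact Tendsto.const_mul _ (tendsto_finsetSum _ fun j _ => (hlim _ j).const_mul _)

lemma IsPicardData.exists_solution (hd : IsPicardData b θ s y0) :
    ∃ y : ℝ → V → ℝ, (∀ t j, y t j ∈ Set.Icc (0 : ℝ) 1) ∧ (∀ t ≤ s, ∀ i, y t i = y0 i) ∧
      (∀ i T, AbsolutelyContinuousOnInterval (fun t => y t i) s T) ∧
      ∀ i, ∀ᵐ t, HasDerivAt (fun r => y r i) (∑ j, b i j t * (y (θ i j t) j - y t i)) t := by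
  obtain ⟨y, hym, hy, hfix⟩ := hd.exists_fixedPoint
  have hint := hd.integrable_picardIntegrand hym hy
  have heq : ∀ i, (fun t => y t i) = fun t => Real.exp (-totalWeight b s i t) *
      (y0 i + ∫ r in s..t, picardIntegrand b θ s y i r) := fun i =>
    funext fun t => (hfix t i).symm
  refine ⟨y, hy, fun t ht i => ?_, fun i T => ?_, fun i => ?_⟩
  · rw [← hfix, hd.picard_of_le ht]
  · rw [heq]
    exact (hd.absolutelyContinuous_totalWeight i T).neg.exp.mul
      ((contDiffOn_const (c := y0 i)).absolutelyContinuousOnInterval.add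
        ((hint i s T).absolutelyContinuousOnInterval_intervalIntegral Set.left_mem_uIcc))
  · filter_upwards [hd.hasDerivAt_totalWeight i, _root_.LocallyIntegrable.ae_hasDerivAt_integral
      (locallyIntegrable_of_intervalIntegrable (hint i))] with t h1 h2
    have h3 := h1.fun_neg.exp.fun_mul ((h2 s).const_add (y0 i))
    rw [heq i]
    refine h3.congr_deriv ?_
    have h4 : Real.exp (-totalWeight b s i t) * Real.exp (totalWeight b s i t) = 1 := by
      rw [← Real.exp_add]
      simp
    have h5 := hfix t i
    unfold picard at h5
    have h6 : ∑ j, b i j t * (y (θ i j t) j - y t i) =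
        ∑ j, b i j t * y (θ i j t) j - (∑ j, b i j t) * y t i := by
      rw [Finset.sum_mul, ← Finset.sum_sub_distrib]
      exact Finset.sum_congr rfl fun j _ => by ring
    rw [h6]
    unfold picardIntegrand at h5 ⊢
    linear_combination (∑ j, b i j t * y (θ i j t) j) * h4 - (∑ j, b i j t) * h5

end Picard

/-- From every constant history with values in `[0, 1]` there starts a solution with values in
`[0, 1]`. -/
theorem exists_isSolution {V : Type*} [Fintype V] [DecidableEq V] {hbar : ℝ}
    {A : ℝ → Matrix V V ℝ} {h : V → V → ℝ → ℝ} (hadm : IsAdmissible hbar A h) {s : ℝ}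
    (hs : 0 ≤ s) {y0 : V → ℝ} (hy0 : ∀ i, y0 i ∈ Set.Icc (0 : ℝ) 1) :
    ∃ x, IsSolution hbar A h s x ∧ (∀ t i, x t i ∈ Set.Icc (0 : ℝ) 1) ∧
      ∀ t ≤ s, ∀ i, x t i = y0 i := by
  set b : V → V → ℝ → ℝ := fun i j =>
    if i = j then 0 else (Set.Ioi s).indicator fun r => A r i j with hb
  set θ : V → V → ℝ → ℝ := fun i j =>
    if i = j then 0 else fun r => r - (Set.Ici 0).indicator (h i j) r with hθ
  have hd : IsPicardData b θ s y0 := by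
    refine ⟨fun i j u v => ?_, fun i j r => ?_, fun i j r hr => ?_, fun i j => ?_, hy0⟩
    · by_cases hij : i = j
      · simp only [hb, hij, if_true]
        exact intervalIntegrable_const
      · simp only [hb, hij, if_false]
        refine IntegrableOn.intervalIntegrable ?_
        rw [integrableOn_indicator_iff measurableSet_Ioi]
        have hsub : Set.Icc 0 (max u v) ⊆ Set.Ici (0 : ℝ) := fun r hr => hr.1
        refine ((hadm.weight_locallyIntegrable i j).integrableOn_compact_subset hsub
          isCompact_Icc).mono_set fun r hr => ?_
        exact ⟨hs.trans (le_of_lt hr.1), hr.2.2⟩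
    · by_cases hij : i = j
      · simp [hb, hij]
      · simp only [hb, hij, if_false]
        exact Set.indicator_nonneg (fun r hr => hadm.weight_nonneg r (hs.trans (le_of_lt hr)) i j) r
    · by_cases hij : i = j
      · simp [hb, hij]
      · simp [hb, hij, hr]
    · by_cases hij : i = j
      · simp only [hθ, hij, if_true]
        exact aemeasurable_const
      · simp only [hθ, hij, if_false]
        exact aemeasurable_id.sub ((aemeasurable_indicator_iff measurableSet_Ici).2
          (hadm.delay_measurable i j hij))
  obtain ⟨x, hx1, hx2, hx3, hx4⟩ := hd.exists_solution
  refine ⟨x, ⟨hs, fun i => ?_, fun i T _ => hx3 i T, fun i => ?_⟩, hx1, hx2⟩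
  · refine (memLp_congr_ae ?_).1 (memLp_const (y0 i))
    exact (ae_restrict_iff' measurableSet_Ico).2
      (ae_of_all _ fun t ht => (hx2 t ht.2.le i).symm)
  · rw [ae_restrict_iff' measurableSet_Ici]
    have hne : ∀ᵐ t : ℝ, t ≠ s := by simp [ae_iff, measure_singleton]
    filter_upwards [hx4 i, hne] with t ht hts hst
    have hst' : s < t := lt_of_le_of_ne hst hts.symm
    refine ht.congr_deriv ?_
    rw [← Finset.add_sum_erase _ _ (Finset.mem_univ i)]
    simp only [hb, if_true, Pi.zero_apply, zero_mul, zero_add]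
    refine Finset.sum_congr rfl fun j hj => ?_
    have hij : i ≠ j := (Finset.ne_of_mem_erase hj).symm
    have ht0 : 0 ≤ t := hs.trans hst
    simp [hij, hθ, hst', ht0]

/-! ### Groups with integrable influence from outside -/

section Isolation

variable {V : Type*} [Fintype V] [DecidableEq V] {hbar : ℝ} {A : ℝ → Matrix V V ℝ}
  {h : V → V → ℝ → ℝ}

/-- Total influence at time `t` of the agents outside `S` on the agents in `S`. -/
def externalWeight (A : ℝ → Matrix V V ℝ) (S : Finset V) (t : ℝ) : ℝ :=
  ∑ k ∈ S, ∑ m ∈ Sᶜ, A t k m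

lemma IsAdmissible.externalWeight_nonneg (hadm : IsAdmissible hbar A h) (S : Finset V) {t : ℝ}
    (ht : 0 ≤ t) : 0 ≤ externalWeight A S t :=
  Finset.sum_nonneg fun k _ => Finset.sum_nonneg fun m _ => hadm.weight_nonneg t ht k m

lemma integrableOn_externalWeight {S : Finset V} {u : Set ℝ}
    (hA : ∀ k ∈ S, ∀ m ∉ S, IntegrableOn (fun t => A t k m) u) :
    IntegrableOn (externalWeight A S) u :=
  integrable_finsetSum _ fun k hk => integrable_finsetSum _ fun m hm =>
    hA k hk m (Finset.mem_compl.1 hm)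

/-- If the agents of `S` start from `0` and no value exceeds `1`, then the agents of `S` rise at
most by the accumulated influence from outside: after subtracting it, the largest value in `S`
cannot become positive. -/
lemma IsSolution.le_integral_externalWeight (hadm : IsAdmissible hbar A h) {s : ℝ}
    {x : ℝ → V → ℝ} (hx : IsSolution hbar A h s x) (hx1 : ∀ t i, x t i ∈ Set.Icc (0 : ℝ) 1)
    {S : Finset V} (hS : ∀ t ≤ s, ∀ k ∈ S, x t k = 0) {T : ℝ} (hT : s ≤ T) {k : V} (hk : k ∈ S) :
    x T k ≤ ∫ r in s..T, externalWeight A S r := by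
  have hs0 : 0 ≤ s := hx.start_nonneg
  set g := externalWeight A S with hg
  have hgi : ∀ t, s ≤ t → IntervalIntegrable g volume s t := fun t ht => by
    rw [intervalIntegrable_iff_integrableOn_Icc_of_le ht]
    exact integrableOn_externalWeight fun k _ m _ =>
      (intervalIntegrable_iff_integrableOn_Icc_of_le ht).1
        (hadm.intervalIntegrable k m hs0 (hs0.trans ht))
  set G : ℝ → ℝ := fun t => ∫ r in s..t, g r with hG
  have hGac : ∀ t, s ≤ t → AbsolutelyContinuousOnInterval G s t := fun t ht =>
    (hgi t ht).absolutelyContinuousOnInterval_intervalIntegral Set.left_mem_uIcc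
  have hGs : G s = 0 := intervalIntegral.integral_same
  have hGmono : ∀ u v, s ≤ u → u ≤ v → G u ≤ G v := fun u v hu huv => by
    refine intervalIntegral.integral_mono_interval le_rfl hu huv ?_ (hgi v (hu.trans huv))
    exact (ae_restrict_iff' measurableSet_Ioc).2
      (ae_of_all _ fun r hr => hadm.externalWeight_nonneg S (hs0.trans hr.1.le))
  set w : V → ℝ → ℝ := fun j t => x t j - G t with hw
  have hwac : ∀ j t, s ≤ t → AbsolutelyContinuousOnInterval (w j) s t := fun j t ht =>
    (hx.absolutelyContinuous j t ht).sub (hGac t ht)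
  have hmax : ∀ j, ∃ t ∈ Set.Icc s T, ∀ r ∈ Set.Icc s T, w j r ≤ w j t := fun j => by
    have hc := (hwac j T hT).continuousOn
    rw [Set.uIcc_of_le hT] at hc
    exact isCompact_Icc.exists_isMaxOn (Set.nonempty_Icc.2 hT) hc
  choose t ht htmax using hmax
  obtain ⟨i, hi, himax⟩ := Finset.exists_max_image S (fun j => w j (t j)) ⟨k, hk⟩
  set M := w i (t i) with hM
  have hwM : ∀ j ∈ S, ∀ r ∈ Set.Icc s T, w j r ≤ M := fun j hj r hr =>
    (htmax j r hr).trans (himax j hj)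
  suffices hM0 : M ≤ 0 by
    have h1 := hwM k hk T ⟨hT, le_rfl⟩
    simp only [hw] at h1
    linarith
  have hws : w i s = 0 := by simp [hw, hGs, hS s le_rfl i hi]
  have hM0 : 0 ≤ M := by
    rw [← hws]
    exact hwM i hi s ⟨le_rfl, hT⟩
  have hmain := le_of_weighted_pull (J := S.erase i) (x := w i) (a := fun j r => A r i j)
    (b := fun _ => M) (B := M) (L := ∑ j ∈ S.erase i, ∫ r in s..(t i), A r i j) (ht i).1
    (hwac i (t i) (ht i).1)
    (fun j _ => hadm.intervalIntegrable i j hs0 (hs0.trans (ht i).1))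
    (fun j _ r hr => hadm.weight_nonneg r (hs0.trans hr.1) i j) ?_ le_rfl (by rw [hws]; exact hM0)
  · simp only [sub_self, max_self, mul_zero, Finset.sum_const_zero, add_zero, sub_zero, hws]
      at hmain
    have h1 : Real.exp (-∑ j ∈ S.erase i, ∫ r in s..(t i), A r i j) * M ≤ 0 := by linarith
    exact nonpos_of_mul_nonpos_right h1 (Real.exp_pos _)
  · filter_upwards [(ae_restrict_iff' measurableSet_Ici).1 (hx.equation i),
      (hgi T hT).ae_hasDerivAt_integral] with r hr hGr hrI
    have hrT : r ∈ Set.Icc s T := ⟨hrI.1, hrI.2.trans (ht i).2⟩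
    have hr0 : 0 ≤ r := hs0.trans hrI.1
    refine ⟨_, (hr hrI.1).sub (hGr (by rwa [Set.uIcc_of_le hT]) s Set.left_mem_uIcc), ?_⟩
    have hsplit : ∑ j ∈ Finset.univ.erase i, A r i j * (x (r - h i j r) j - x r i) =
        ∑ j ∈ S.erase i, A r i j * (x (r - h i j r) j - x r i) +
          ∑ j ∈ Sᶜ, A r i j * (x (r - h i j r) j - x r i) := by
      rw [← Finset.sum_union]
      · congr 1
        ext j
        simp only [Finset.mem_erase, Finset.mem_univ, Finset.mem_union, Finset.mem_compl]
        constructor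
        · rintro ⟨h1, -⟩
          by_cases hj : j ∈ S
          · exact Or.inl ⟨h1, hj⟩
          · exact Or.inr hj
        · rintro (⟨h1, -⟩ | h1)
          · exact ⟨h1, trivial⟩
          · exact ⟨by rintro rfl; exact h1 hi, trivial⟩
      · exact Finset.disjoint_left.2 fun j h1 h2 =>
          Finset.mem_compl.1 h2 (Finset.mem_of_mem_erase h1)
    have hout : ∑ j ∈ Sᶜ, A r i j * (x (r - h i j r) j - x r i) ≤ g r := by
      refine le_trans (Finset.sum_le_sum fun j _ => ?_) (Finset.single_le_sum
        (f := fun k => ∑ m ∈ Sᶜ, A r k m)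
        (fun k _ => Finset.sum_nonneg fun m _ => hadm.weight_nonneg r hr0 k m) hi)
      exact mul_le_of_le_one_right (hadm.weight_nonneg r hr0 i j)
        (by linarith [(hx1 (r - h i j r) j).2, (hx1 r i).1])
    have hin : ∑ j ∈ S.erase i, A r i j * (x (r - h i j r) j - x r i) ≤
        ∑ j ∈ S.erase i, A r i j * (M - w i r) := by
      refine Finset.sum_le_sum fun j hj => mul_le_mul_of_nonneg_left ?_
        (hadm.weight_nonneg r hr0 i j)
      have hd := hadm.delay_mem i j (Finset.ne_of_mem_erase hj).symm r hr0
      have hGr0 : 0 ≤ G r := by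
        rw [← hGs]
        exact hGmono s r le_rfl hrI.1
      have hj' : x (r - h i j r) j ≤ M + G r := by
        rcases le_total (r - h i j r) s with hle | hle
        · rw [hS _ hle j (Finset.mem_of_mem_erase hj)]
          linarith
        · have h1 := hwM j (Finset.mem_of_mem_erase hj) (r - h i j r)
            ⟨hle, by linarith [hd.1, hrT.2]⟩
          have h2 := hGmono (r - h i j r) r hle (by linarith [hd.1])
          simp only [hw] at h1
          linarith
      simp only [hw]
      linarith
    rw [hsplit]
    linarith

/-- Two agents separated by a cut which carries integrable weight in both directions do not reach
consensus from the history equal to `1` on one side and `0` on the other side, if the starting time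
is late. -/
lemma not_establishesConsensus_of_cut (hadm : IsAdmissible hbar A h) {S : Finset V}
    (hS : ∀ k ∈ S, ∀ m ∉ S, IntegrableOn (fun t => A t k m) (Set.Ici 0) ∧
      IntegrableOn (fun t => A t m k) (Set.Ici 0)) {i j : V} (hi : i ∈ S) (hj : j ∉ S) :
    ¬ EstablishesConsensus hbar A h {i, j} := by
  intro hcons
  have h1 : IntegrableOn (externalWeight A S) (Set.Ioi 0) :=
    (integrableOn_externalWeight fun k hk m hm => (hS k hk m hm).1).mono_set Set.Ioi_subset_Ici_self
  have h2 : IntegrableOn (externalWeight A Sᶜ) (Set.Ioi 0) :=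
    (integrableOn_externalWeight fun k hk m hm =>
      (hS m (by simpa using hm) k (Finset.mem_compl.1 hk)).2).mono_set Set.Ioi_subset_Ici_self
  have htail : ∀ U : Finset V, IntegrableOn (externalWeight A U) (Set.Ioi 0) →
      ∀ᶠ s in atTop, 0 ≤ s ∧ ∀ t, s ≤ t → ∫ r in s..t, externalWeight A U r ≤ 1 / 4 := by
    intro U hU
    have hlim := intervalIntegral_tendsto_integral_Ioi 0 hU tendsto_id
    have hii : ∀ u v, 0 ≤ u → 0 ≤ v → IntervalIntegrable (externalWeight A U) volume u v :=
      fun u v hu hv => intervalIntegrable_iff.2 <| hU.mono_set fun r hr =>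
        lt_of_le_of_lt (le_min hu hv) hr.1
    filter_upwards [hlim.eventually (lt_mem_nhds (sub_lt_self _ (by norm_num : (0 : ℝ) < 1 / 4))),
      eventually_ge_atTop 0] with s hs hs0
    refine ⟨hs0, fun t hst => ?_⟩
    have h3 := intervalIntegral.integral_add_adjacent_intervals (hii 0 s le_rfl hs0)
      (hii s t hs0 (hs0.trans hst))
    have h4 : ∫ r in (0 : ℝ)..t, externalWeight A U r ≤
        ∫ r in Set.Ioi 0, externalWeight A U r := by
      rw [intervalIntegral.integral_of_le (hs0.trans hst)]
      refine setIntegral_mono_set hU ?_ (ae_of_all _ fun r hr => hr.1)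
      exact (ae_restrict_iff' measurableSet_Ioi).2
        (ae_of_all _ fun r hr => hadm.externalWeight_nonneg U (le_of_lt hr))
    simp only [id] at hs
    linarith
  obtain ⟨s, ⟨hs0, hs1⟩, -, hs2⟩ := ((htail S h1).and (htail Sᶜ h2)).exists
  obtain ⟨x, hx, hx1, hxs⟩ := exists_isSolution hadm hs0
    (y0 := fun k => if k ∈ S then 1 else 0) (fun k => by split_ifs <;> simp)
  obtain ⟨c, hc⟩ := hcons s x hx
  have hci := hc i (by simp)
  have hcj := hc j (by simp)
  have hlow : ∀ᶠ t in atTop, 3 / 4 ≤ x t i := by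
    filter_upwards [eventually_ge_atTop s] with t ht
    have h3 := (hx.const_sub 1).le_integral_externalWeight hadm
      (fun r k => ⟨by linarith [(hx1 r k).2], by linarith [(hx1 r k).1]⟩)
      (fun r hr k hk => by simp [hxs r hr k, hk]) ht hi
    linarith [hs1 t ht]
  have hupp : ∀ᶠ t in atTop, x t j ≤ 1 / 4 := by
    filter_upwards [eventually_ge_atTop s] with t ht
    have h3 := hx.le_integral_externalWeight hadm hx1 (S := Sᶜ)
      (fun r hr k hk => by simp [hxs r hr k, Finset.mem_compl.1 hk]) ht (Finset.mem_compl.2 hj)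
    linarith [hs2 t ht]
  have h3 := ge_of_tendsto hci hlow
  have h4 := le_of_tendsto hcj hupp
  linarith

end Isolation

/-! ### The persistent graph -/

section Graph

variable {V : Type*} {hbar : ℝ} {A : ℝ → Matrix V V ℝ} {h : V → V → ℝ → ℝ}

lemma IsAdmissible.adj_iff_not_integrableOn (hadm : IsAdmissible hbar A h) (i j : V) :
    (persistentGraph A).Adj j i ↔ ¬ IntegrableOn (fun t => A t i j) (Set.Ici 0) := by
  have hm : AEStronglyMeasurable (fun t => A t i j) (volume.restrict (Set.Ici 0)) :=
    (hadm.weight_locallyIntegrable i j).aestronglyMeasurable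
  have h0 : 0 ≤ᵐ[volume.restrict (Set.Ici 0)] fun t => A t i j :=
    (ae_restrict_iff' measurableSet_Ici).2 (ae_of_all _ fun t ht => hadm.weight_nonneg t ht i j)
  have h1 : IntegrableOn (fun t => A t i j) (Set.Ici 0) ↔
      ∫⁻ t in Set.Ici (0 : ℝ), ENNReal.ofReal (A t i j) < ⊤ := by
    rw [← hasFiniteIntegral_iff_ofReal h0]
    exact ⟨fun hh => hh.2, fun hh => ⟨hm, hh⟩⟩
  rw [h1, not_lt, top_le_iff]
  rfl

variable {tstar : ℝ} {τ : ℕ → ℝ} {K l : ℝ}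

lemma IsWindowing.sum_range_windowWeight (hadm : IsAdmissible hbar A h) (h0 : 0 ≤ tstar)
    (hτ : IsWindowing hbar A tstar τ K l) (i j : V) (N : ℕ) :
    ∑ p ∈ Finset.range N, windowWeight A τ p i j = ∫ t in (τ 0)..(τ N), A t i j := by
  have hpos : ∀ p, 0 ≤ τ p := fun p => by linarith [hτ.start_le hadm p, hadm.hbar_nonneg]
  exact intervalIntegral.sum_integral_adjacent_intervals fun k _ =>
    hadm.intervalIntegrable i j (hpos k) (hpos (k + 1))

lemma IsWindowing.integrableOn_iff_summable (hadm : IsAdmissible hbar A h) (h0 : 0 ≤ tstar)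
    (hτ : IsWindowing hbar A tstar τ K l) (i j : V) :
    IntegrableOn (fun t => A t i j) (Set.Ici 0) ↔ Summable fun p => windowWeight A τ p i j := by
  have hpos : ∀ p, 0 ≤ τ p := fun p => by linarith [hτ.start_le hadm p, hadm.hbar_nonneg]
  have hmono := hτ.monotone hadm
  rw [integrableOn_Ici_iff_integrableOn_Ioi]
  constructor
  · intro hint
    refine summable_of_sum_range_le (c := ∫ t in Set.Ioi 0, A t i j)
      (fun p => hτ.windowWeight_nonneg hadm h0 p i j) fun N => ?_
    rw [hτ.sum_range_windowWeight hadm h0,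
      intervalIntegral.integral_of_le (hmono (Nat.zero_le N))]
    refine setIntegral_mono_set hint ?_ (ae_of_all _ fun r hr => (hpos 0).trans_lt hr.1)
    exact (ae_restrict_iff' measurableSet_Ioi).2
      (ae_of_all _ fun r hr => hadm.weight_nonneg r (le_of_lt hr) i j)
  · intro hsum
    obtain ⟨B, hB⟩ := hsum.hasSum.tendsto_sum_nat.bddAbove_range
    refine integrableOn_Ioi_of_intervalIntegral_norm_bounded
      ((∫ t in (0 : ℝ)..(τ 0), A t i j) + B) 0 (b := τ) (l := atTop) (fun N => ?_) hτ.tendsto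
      (Eventually.of_forall fun N => ?_)
    · exact (intervalIntegrable_iff_integrableOn_Ioc_of_le (hpos N)).1
        (hadm.intervalIntegrable i j le_rfl (hpos N))
    · have h1 : ∫ t in (0 : ℝ)..(τ N), ‖A t i j‖ = ∫ t in (0 : ℝ)..(τ N), A t i j := by
        refine intervalIntegral.integral_congr fun t ht => ?_
        rw [Set.uIcc_of_le (hpos N)] at ht
        exact Real.norm_of_nonneg (hadm.weight_nonneg t ht.1 i j)
      have h2 := intervalIntegral.integral_add_adjacent_intervals
        (hadm.intervalIntegrable i j le_rfl (hpos 0))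
        (hadm.intervalIntegrable i j (hpos 0) (hpos N))
      have h3 := hB ⟨N, rfl⟩
      simp only [hτ.sum_range_windowWeight hadm h0] at h3
      rw [h1]
      linarith

lemma IsWindowing.adj_iff_not_summable (hadm : IsAdmissible hbar A h) (h0 : 0 ≤ tstar)
    (hτ : IsWindowing hbar A tstar τ K l) (i j : V) :
    (persistentGraph A).Adj j i ↔ ¬ Summable fun p => windowWeight A τ p i j := by
  rw [hadm.adj_iff_not_integrableOn, hτ.integrableOn_iff_summable hadm h0]

lemma persistentGraph_adj_comm (hadm : IsAdmissible hbar A h) (hnits : IsNITS A)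
    (hsum : UniformlyLocallySummable A) (i j : V) :
    (persistentGraph A).Adj i j ↔ (persistentGraph A).Adj j i := by
  obtain ⟨τ, K, l, hτ⟩ := exists_isWindowing hadm hnits hsum 0
  have key : ∀ i j, (Summable fun p => windowWeight A τ p i j) →
      Summable fun p => windowWeight A τ p j i := fun i j hs =>
    Summable.of_nonneg_of_le (fun p => hτ.windowWeight_nonneg hadm le_rfl p j i)
      (fun p => hτ.symm p j i) (hs.mul_left K)
  rw [hτ.adj_iff_not_summable hadm le_rfl, hτ.adj_iff_not_summable hadm le_rfl]
  exact not_congr ⟨key j i, key i j⟩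

lemma reachable_iff_reflTransGen {G : Digraph V} (hG : ∀ i j, G.Adj i j ↔ G.Adj j i) (i j : V) :
    G.toSimpleGraphInclusive.Reachable i j ↔ Relation.ReflTransGen G.Adj i j := by
  rw [SimpleGraph.reachable_iff_reflTransGen]
  constructor
  · exact Relation.ReflTransGen.mono (fun a b hab => hab.2.elim id (hG b a).1) i j
  · intro hr
    induction hr with
    | refl => exact Relation.ReflTransGen.refl
    | @tail b c _ hbc ih =>
      by_cases hne : b = c
      · rwa [← hne]
      · exact ih.tail ⟨hne, Or.inl hbc⟩

variable [Fintype V] [DecidableEq V]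

/-- Limits propagate along walks of the persistent graph: two agents with distinct limits have
summable integrated weights, so they are not adjacent. -/
lemma IsSolution.tendsto_of_reflTransGen (hadm : IsAdmissible hbar A h) (hnits : IsNITS A)
    (hsum : UniformlyLocallySummable A) {x : ℝ → V → ℝ} (hx : IsSolution hbar A h tstar x)
    {i j : V} (hij : Relation.ReflTransGen (persistentGraph A).Adj i j) {c : ℝ}
    (hc : Tendsto (fun t => x t i) atTop (𝓝 c)) : Tendsto (fun t => x t j) atTop (𝓝 c) := by
  obtain ⟨τ, K, l, hτ⟩ := exists_isWindowing hadm hnits hsum tstar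
  obtain ⟨m, hs⟩ := hx.isEnvelopeSystem hadm hτ
  induction hij with
  | refl => exact hc
  | @tail a b _ hab ih =>
    obtain ⟨y, hy1, hy2⟩ := hx.exists_tendsto hadm hτ a
    obtain ⟨w, hw1, hw2⟩ := hx.exists_tendsto hadm hτ b
    obtain rfl : y = c := tendsto_nhds_unique hy2 ih
    have hab' := (persistentGraph_adj_comm hadm hnits hsum a b).1 hab
    rw [hτ.adj_iff_not_summable hadm hx.start_nonneg] at hab hab'
    rcases lt_trichotomy y w with hlt | heq | hgt
    · exact absurd (hs.summable_coupling hy1 hw1 hlt) hab'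
    · rwa [heq]
    · exact absurd (hs.summable_coupling hw1 hy1 hgt) hab

/-- Consensus between two agents forces them to be joined by a walk: otherwise the agents reachable
from one of them are cut off by integrable weights. -/
lemma EstablishesConsensus.reflTransGen (hadm : IsAdmissible hbar A h)
    (hG : ∀ i j, (persistentGraph A).Adj i j ↔ (persistentGraph A).Adj j i) {i j : V}
    (hcons : EstablishesConsensus hbar A h {i, j}) :
    Relation.ReflTransGen (persistentGraph A).Adj i j := by
  classical
  by_contra hij
  refine not_establishesConsensus_of_cut hadm
    (S := Finset.univ.filter fun k => Relation.ReflTransGen (persistentGraph A).Adj i k)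
    (fun k hk m hm => ?_) (i := i) (j := j) (by simp [Relation.ReflTransGen.refl])
    (by simpa using hij) hcons
  simp only [Finset.mem_filter, Finset.mem_univ, true_and] at hk hm
  have hkm : ¬ (persistentGraph A).Adj k m := fun hadj => hm (hk.tail hadj)
  have hmk : ¬ (persistentGraph A).Adj m k := fun hadj => hkm ((hG m k).1 hadj)
  rw [hadm.adj_iff_not_integrableOn, not_not] at hkm hmk
  exact ⟨hmk, hkm⟩

end Graph

end DelayedConsensus

/-- Connected components of the persistent graph are those of its underlying undirected graph;
the second conjunct records that the persistent graph is undirected, and the third one that lying in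
one component means being joined by a (directed) walk. -/
theorem mainTheorem3 {V : Type*} [Fintype V] [DecidableEq V] [Nonempty V]
    (hbar : ℝ) (A : ℝ → Matrix V V ℝ) (h : V → V → ℝ → ℝ)
    (hadm : DelayedConsensus.IsAdmissible hbar A h)
    (hnits : DelayedConsensus.IsNITS A)
    (hsum : DelayedConsensus.UniformlyLocallySummable A) :
    (∀ (tstar : ℝ) (x : ℝ → V → ℝ), DelayedConsensus.IsSolution hbar A h tstar x →
      ∀ i, ∃ c : ℝ, Tendsto (fun t => x t i) atTop (𝓝 c)) ∧
    (∀ i j, (DelayedConsensus.persistentGraph A).Adj i j ↔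
      (DelayedConsensus.persistentGraph A).Adj j i) ∧
    (∀ i j,
      (DelayedConsensus.persistentGraph A).toSimpleGraphInclusive.connectedComponentMk i =
        (DelayedConsensus.persistentGraph A).toSimpleGraphInclusive.connectedComponentMk j ↔
      Relation.ReflTransGen (DelayedConsensus.persistentGraph A).Adj i j) ∧
    (∀ i j, DelayedConsensus.EstablishesConsensus hbar A h {i, j} ↔
      (DelayedConsensus.persistentGraph A).toSimpleGraphInclusive.connectedComponentMk i =
        (DelayedConsensus.persistentGraph A).toSimpleGraphInclusive.connectedComponentMk j) ∧
    (DelayedConsensus.EstablishesConsensus hbar A h Set.univ ↔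
      (DelayedConsensus.persistentGraph A).toSimpleGraphInclusive.Connected) := by
  have hG := DelayedConsensus.persistentGraph_adj_comm hadm hnits hsum
  have hreach := DelayedConsensus.reachable_iff_reflTransGen hG
  have hconv : ∀ (tstar : ℝ) (x : ℝ → V → ℝ), DelayedConsensus.IsSolution hbar A h tstar x →
      ∀ i, ∃ c : ℝ, Tendsto (fun t => x t i) atTop (𝓝 c) := by
    intro tstar x hx i
    obtain ⟨τ, K, l, hτ⟩ := DelayedConsensus.exists_isWindowing hadm hnits hsum tstar
    obtain ⟨y, -, hy⟩ := hx.exists_tendsto hadm hτ i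
    exact ⟨y, hy⟩
  have hpair : ∀ i j, DelayedConsensus.EstablishesConsensus hbar A h {i, j} →
      (DelayedConsensus.persistentGraph A).toSimpleGraphInclusive.Reachable i j :=
    fun i j hc => (hreach i j).2 (hc.reflTransGen hadm hG)
  refine ⟨hconv, hG, fun i j => ?_, fun i j => ?_, ?_⟩
  · rw [SimpleGraph.ConnectedComponent.eq, hreach]
  · rw [SimpleGraph.ConnectedComponent.eq]
    refine ⟨hpair i j, fun hr tstar x hx => ?_⟩
    obtain ⟨c, hc⟩ := hconv tstar x hx i
    refine ⟨c, ?_⟩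
    rintro k (rfl | rfl)
    · exact hc
    · exact hx.tendsto_of_reflTransGen hadm hnits hsum ((hreach i _).1 hr) hc
  · constructor
    · intro hc
      refine ⟨fun i j => hpair i j fun tstar x hx => ?_⟩
      obtain ⟨c, hcx⟩ := hc tstar x hx
      exact ⟨c, fun k _ => hcx k trivial⟩
    · intro hconn tstar x hx
      obtain ⟨i⟩ := ‹Nonempty V›
      obtain ⟨c, hc⟩ := hconv tstar x hx i
      exact ⟨c, fun k _ => hx.tendsto_of_reflTransGen hadm hnits hsum
        ((hreach i k).1 (hconn.preconnected i k)) hc⟩
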